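/- Let $K\subset\mathbb{C}$ be an imaginary quadratic field with ring of integers $\mathcal{O}_K$, and for an integer $f\ge 1$ let $\mathcal{O}_f=\mathbb{Z}+f\mathcal{O}_K$. A lattice $L\subset K$ (a free abelian subgroup of rank $2$) has conductor $f$ if $\{\alpha\in K:\alpha L\subset L\}=\mathcal{O}_f$. Let $L_1=\mathbb{Z}+\mathbb{Z}\tau_1$ and $L_2=\mathbb{Z}+\mathbb{Z}\tau_2$ be lattices in $K$ of conductors $f_1$ and $f_2$, let $E_i=\mathbb{C}/L_i$, and let $\tilde E=\mathbb{C}/L_1L_2$. Let $\mathrm{Ext}^1_{an}(E_1,E_2)$ be the set of equivalence classes of extensions $0\to E_2\to S\to E_1\to 0$ of complex tori, and identify $\tilde E$ with $\mathrm{Ext}^1_{an}(E_1,E_2)$ by sending the class of $z\in\mathbb{C}$ to the class of $$0\to E_2\to \mathbb{C}^2/\Lambda_z\to E_1\to 0,\qquad \Lambda_z=\mathbb{Z}\binom{\tau_2}{0}+\mathbb{Z}\binom{1}{0}+\mathbb{Z}\binom{z}{\tau_1}+\mathbb{Z}\binom{0}{1},$$ whose maps are induced by $w\mapsto(w,0)$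 and $(u,v)\mapsto v$. **Theorem.** Let $P\in\tilde E$ be a torsion point of order $n\ge1$, and let $0\to E_2\to S\to E_1\to 0$ be any extension in the class corresponding to $P$. Then there is an isomorphism of complex tori $$S\;\cong\;\mathbb{C}/\mathcal{O}_{n\cdot\mathrm{lcm}(f_1,f_2)}\;\oplus\;\tilde E/\langle P\rangle .$$ -/

import Mathlib

/-! ### Complex tori, their homomorphisms, products and finite quotients -/

/-- A complex torus `V / Λ`: a finite-dimensional complex vector space `V` together with a lattice
`Λ`, i.e. a discrete subgroup which spans `V` over `ℝ`. -/
structure ComplexTorus where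
  V : Type
  [normedAddCommGroup : NormedAddCommGroup V]
  [normedSpace : NormedSpace ℂ V]
  [finiteDimensional : FiniteDimensional ℂ V]
  Λ : Submodule ℤ V
  discrete : DiscreteTopology Λ
  span_eq_top : Submodule.span ℝ (Λ : Set V) = ⊤

namespace ComplexTorus

attribute [instance] ComplexTorus.normedAddCommGroup ComplexTorus.normedSpace
  ComplexTorus.finiteDimensional

/-- The group of points `V / Λ` of a complex torus. -/
abbrev Pts (A : ComplexTorus) : Type := A.V ⧸ A.Λ

/-- The projection `V → V / Λ`. -/
abbrev proj (A : ComplexTorus) : A.V →ₗ[ℤ] A.Pts := A.Λ.mkQ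

/-- A map between complex tori `V / Λ → W / M` is holomorphic for the quotient complex structures:
near every point it lifts to a holomorphic map `V → W`. -/
def IsHolomorphic {A B : ComplexTorus} (φ : A.Pts → B.Pts) : Prop :=
  ∀ v : A.V, ∃ g : A.V → B.V, AnalyticAt ℂ g v ∧
    ∀ᶠ x in nhds v, φ (A.proj x) = B.proj (g x)

/-- Homomorphisms of complex tori: holomorphic group homomorphisms. -/
structure Hom (A B : ComplexTorus) extends A.Pts →+ B.Pts where
  holomorphic : IsHolomorphic (A := A) (B := B) toFun

/-- Isomorphisms of complex tori: biholomorphic group isomorphisms. -/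
structure Iso (A B : ComplexTorus) extends A.Pts ≃+ B.Pts where
  holomorphic : IsHolomorphic (A := A) (B := B) toFun
  holomorphic_inv : IsHolomorphic (A := B) (B := A) invFun

theorem IsHolomorphic.id (A : ComplexTorus) : IsHolomorphic (A := A) (B := A) (fun x => x) :=
  fun _ => ⟨fun x => x, analyticAt_id, Filter.Eventually.of_forall fun _ => rfl⟩

theorem IsHolomorphic.comp {A B C : ComplexTorus} {ψ : B.Pts → C.Pts} {φ : A.Pts → B.Pts}
    (hψ : IsHolomorphic ψ) (hφ : IsHolomorphic φ) :
    IsHolomorphic (A := A) (B := C) (fun x => ψ (φ x)) := by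
  intro v
  obtain ⟨g, hg, hg'⟩ := hφ v
  obtain ⟨k, hk, hk'⟩ := hψ (g v)
  refine ⟨fun x => k (g x), hk.fun_comp hg, ?_⟩
  filter_upwards [hg', hg.continuousAt.eventually hk'] with x h1 h2
  rw [h1, h2]

/-- The identity isomorphism. -/
def Iso.refl (A : ComplexTorus) : Iso A A :=
  { AddEquiv.refl A.Pts with
    holomorphic := IsHolomorphic.id A
    holomorphic_inv := IsHolomorphic.id A }

/-- The inverse isomorphism. -/
def Iso.symm {A B : ComplexTorus} (e : Iso A B) : Iso B A :=
  { e.toAddEquiv.symm with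
    holomorphic := e.holomorphic_inv
    holomorphic_inv := e.holomorphic }

/-- Composition of isomorphisms. -/
def Iso.trans {A B C : ComplexTorus} (e : Iso A B) (e' : Iso B C) : Iso A C :=
  { e.toAddEquiv.trans e'.toAddEquiv with
    holomorphic := e'.holomorphic.comp e.holomorphic
    holomorphic_inv := e.holomorphic_inv.comp e'.holomorphic_inv }

theorem isHolomorphic_of_linear {A B : ComplexTorus} (T : A.V →ₗ[ℂ] B.V) {φ : A.Pts → B.Pts}
    (h : ∀ x, φ (A.proj x) = B.proj (T x)) : IsHolomorphic φ :=
  fun v => ⟨T, T.toContinuousLinearMap.analyticAt v, Filter.Eventually.of_forall h⟩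

/-- The homomorphism of complex tori induced by a `ℂ`-linear map `T` with `T Λ ⊆ M`. -/
def Hom.ofLinear {A B : ComplexTorus} (T : A.V →ₗ[ℂ] B.V)
    (h : ∀ x ∈ A.Λ, T x ∈ B.Λ) : Hom A B :=
  { (Submodule.mapQ A.Λ B.Λ (T.restrictScalars ℤ) h).toAddMonoidHom with
    holomorphic := isHolomorphic_of_linear T fun _ => rfl }

@[simp] theorem Hom.ofLinear_proj {A B : ComplexTorus} (T : A.V →ₗ[ℂ] B.V)
    (h : ∀ x ∈ A.Λ, T x ∈ B.Λ) (x : A.V) :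
    (Hom.ofLinear T h).toFun (A.proj x) = B.proj (T x) := rfl

/-- The isomorphism of complex tori induced by a `ℂ`-linear isomorphism `T` with `T Λ = M`. -/
def Iso.ofLinear {A B : ComplexTorus} (T : A.V ≃ₗ[ℂ] B.V)
    (h : ∀ x ∈ A.Λ, T x ∈ B.Λ) (h' : ∀ x ∈ B.Λ, T.symm x ∈ A.Λ) : Iso A B where
  toFun := (Hom.ofLinear T.toLinearMap h).toFun
  invFun := (Hom.ofLinear T.symm.toLinearMap h').toFun
  left_inv x := by
    obtain ⟨x, rfl⟩ := A.Λ.mkQ_surjective x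
    change A.proj (T.symm (T x)) = A.proj x
    rw [T.symm_apply_apply]
  right_inv x := by
    obtain ⟨x, rfl⟩ := B.Λ.mkQ_surjective x
    change B.proj (T (T.symm x)) = B.proj x
    rw [T.apply_symm_apply]
  map_add' := (Hom.ofLinear T.toLinearMap h).map_add'
  holomorphic := (Hom.ofLinear T.toLinearMap h).holomorphic
  holomorphic_inv := (Hom.ofLinear T.symm.toLinearMap h').holomorphic

/-- The product `A ⊕ B` of two complex tori. -/
noncomputable def prod (A B : ComplexTorus) : ComplexTorus where
  V := A.V × B.V
  Λ := A.Λ.prod B.Λ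
  discrete := by
    have := A.discrete
    have := B.discrete
    refine DiscreteTopology.of_continuous_injective
      (f := fun x : A.Λ.prod B.Λ =>
        ((⟨x.1.1, x.2.1⟩, ⟨x.1.2, x.2.2⟩) : A.Λ × B.Λ)) ?_ ?_
    · fun_prop
    · rintro ⟨⟨a, b⟩, h⟩ ⟨⟨c, d⟩, h'⟩ hh
      simpa using hh
  span_eq_top := by
    have h1 : (⊤ : Submodule ℝ A.V).map (LinearMap.inl ℝ A.V B.V) ≤
        Submodule.span ℝ (A.Λ.prod B.Λ : Set (A.V × B.V)) := by
      rw [← A.span_eq_top, Submodule.map_span]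
      refine Submodule.span_mono ?_
      rintro _ ⟨x, hx, rfl⟩
      exact ⟨hx, B.Λ.zero_mem⟩
    have h2 : (⊤ : Submodule ℝ B.V).map (LinearMap.inr ℝ A.V B.V) ≤
        Submodule.span ℝ (A.Λ.prod B.Λ : Set (A.V × B.V)) := by
      rw [← B.span_eq_top, Submodule.map_span]
      refine Submodule.span_mono ?_
      rintro _ ⟨x, hx, rfl⟩
      exact ⟨A.Λ.zero_mem, hx⟩
    refine eq_top_iff.2 fun x _ => ?_
    have := Submodule.add_mem _ (h1 ⟨x.1, trivial, rfl⟩) (h2 ⟨x.2, trivial, rfl⟩)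
    simpa using this

/-- The quotient `A / ⟨P⟩` of a complex torus `A = V / Λ` by the finite subgroup generated by a
torsion point `P`, as the complex torus `V / Λ'` where `Λ'` is the preimage of `⟨P⟩` in `V`. -/
def quot (A : ComplexTorus) (P : A.Pts) (hP : IsOfFinAddOrder P) : ComplexTorus where
  V := A.V
  Λ := (Submodule.span ℤ {P}).comap A.proj
  discrete := by
    have := A.discrete
    have hn : addOrderOf P ≠ 0 := (addOrderOf_pos_iff.2 hP).ne'
    have key : ∀ x : (Submodule.span ℤ {P}).comap A.proj,
        (addOrderOf P) • (x : A.V) ∈ A.Λ := by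
      rintro ⟨x, hx⟩
      obtain ⟨m, hm⟩ := Submodule.mem_span_singleton.1 (Submodule.mem_comap.1 hx)
      have : A.proj ((addOrderOf P) • x) = 0 := by
        rw [map_nsmul, ← hm, smul_comm, addOrderOf_nsmul_eq_zero, smul_zero]
      exact (Submodule.Quotient.mk_eq_zero A.Λ).1 this
    refine DiscreteTopology.of_continuous_injective
      (f := fun x => (⟨(addOrderOf P) • (x : A.V), key x⟩ : A.Λ)) ?_ ?_
    · fun_prop
    · intro x y hxy
      have h : (addOrderOf P) • (x : A.V) = (addOrderOf P) • (y : A.V) :=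
        congrArg Subtype.val hxy
      rw [← Nat.cast_smul_eq_nsmul ℝ, ← Nat.cast_smul_eq_nsmul ℝ] at h
      exact Subtype.ext (smul_right_injective A.V (Nat.cast_ne_zero.2 hn : (addOrderOf P : ℝ) ≠ 0) h)
  span_eq_top := by
    refine eq_top_iff.2 (A.span_eq_top ▸ Submodule.span_mono fun x hx => ?_)
    have : A.proj x = 0 := (Submodule.Quotient.mk_eq_zero A.Λ).2 hx
    change A.proj x ∈ Submodule.span ℤ {P}
    rw [this]
    exact Submodule.zero_mem _

/-! ### Extensions of complex tori -/

/-- An extension `0 → E₂ → S → E₁ → 0` of complex tori. -/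
structure Extension (E₁ E₂ : ComplexTorus) where
  S : ComplexTorus
  i : Hom E₂ S
  p : Hom S E₁
  injective : Function.Injective i.toFun
  exact : Function.Exact i.toFun p.toFun
  surjective : Function.Surjective p.toFun

/-- Equivalence of extensions: an isomorphism of the middle terms inducing the identity on
`E₂` and on `E₁`. -/
instance Extension.setoid (E₁ E₂ : ComplexTorus) : Setoid (Extension E₁ E₂) where
  r X Y := ∃ e : Iso X.S Y.S, (∀ x, e.toFun (X.i.toFun x) = Y.i.toFun x) ∧
    ∀ s, Y.p.toFun (e.toFun s) = X.p.toFun s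
  iseqv :=
    { refl := fun X => ⟨Iso.refl X.S, fun _ => rfl, fun _ => rfl⟩
      symm := by
        rintro X Y ⟨e, h1, h2⟩
        refine ⟨e.symm, fun x => ?_, fun s => ?_⟩
        · rw [← h1 x]
          exact e.left_inv _
        · rw [← h2]
          exact congrArg _ (e.right_inv s)
      trans := by
        rintro X Y Z ⟨e, h1, h2⟩ ⟨e', h1', h2'⟩
        refine ⟨e.trans e', fun x => ?_, fun s => ?_⟩
        · exact (congrArg e'.toFun (h1 x)).trans (h1' x)
        · exact (h2' _).trans (h2 s) }

/-- `Ext¹_an(E₁, E₂)`: the set of equivalence classes of extensions `0 → E₂ → S → E₁ → 0` of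
complex tori. -/
def Ext1an (E₁ E₂ : ComplexTorus) : Type 1 := Quotient (Extension.setoid E₁ E₂)

/-- The class of an extension in `Ext¹_an(E₁, E₂)`. -/
def Extension.cls {E₁ E₂ : ComplexTorus} (X : Extension E₁ E₂) : Ext1an E₁ E₂ := Quotient.mk _ X

end ComplexTorus

/-! ### Rank one lattices in an imaginary quadratic field `K ⊂ ℂ` -/

/-- `K ⊂ ℂ` is an imaginary quadratic field. -/
class ImaginaryQuadratic (K : IntermediateField ℚ ℂ) : Prop where
  finrank_eq : Module.finrank ℚ K = 2
  exists_im_ne_zero : ∃ x ∈ K, x.im ≠ 0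

section Lattices

variable {K : IntermediateField ℚ ℂ}

/-- The image in `ℂ` of an additive subgroup of `K`. -/
noncomputable def toComplex (L : Submodule ℤ K) : Submodule ℤ ℂ :=
  L.map (K.val.toLinearMap.restrictScalars ℤ)

theorem mem_toComplex {L : Submodule ℤ K} {x : K} : (x : ℂ) ∈ toComplex L ↔ x ∈ L := by
  constructor
  · rintro ⟨y, hy, h⟩
    have : y = x := Subtype.ext h
    exact this ▸ hy
  · exact fun h => ⟨x, h, rfl⟩

/-- The order `𝒪_f = ℤ + f 𝒪_K` of conductor `f` in `K`. -/
noncomputable def quadraticOrder (K : IntermediateField ℚ ℂ) (f : ℕ+) : Subring K where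
  carrier := {x | ∃ (a : ℤ) (y : NumberField.RingOfIntegers K), x = a + (f : ℕ) * (y : K)}
  mul_mem' := by
    rintro _ _ ⟨a, y, rfl⟩ ⟨b, z, rfl⟩
    refine ⟨a * b, a * z + b * y + (f : ℕ) * (y * z), ?_⟩
    simp
    ring
  one_mem' := ⟨1, 0, by simp⟩
  add_mem' := by
    rintro _ _ ⟨a, y, rfl⟩ ⟨b, z, rfl⟩
    refine ⟨a + b, y + z, ?_⟩
    simp
    ring
  zero_mem' := ⟨0, 0, by simp⟩
  neg_mem' := by
    rintro _ ⟨a, y, rfl⟩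
    refine ⟨-a, -y, ?_⟩
    simp
    ring

/-- The order `𝒪_f`, regarded as an additive subgroup of `K`. -/
noncomputable def orderLattice (K : IntermediateField ℚ ℂ) (f : ℕ+) : Submodule ℤ K :=
  (quadraticOrder K f).toAddSubgroup.toIntSubmodule

/-- The ring of multipliers `R(L) = {α ∈ K : α L ⊆ L}`. -/
noncomputable def multiplierRing (L : Submodule ℤ K) : Subring K where
  carrier := {α | ∀ x ∈ L, α * x ∈ L}
  mul_mem' := fun {a b} ha hb x hx => by rw [mul_assoc]; exact ha _ (hb _ hx)
  one_mem' := fun x hx => by rwa [one_mul]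
  add_mem' := fun {a b} ha hb x hx => by rw [add_mul]; exact L.add_mem (ha _ hx) (hb _ hx)
  zero_mem' := fun x _ => by rw [zero_mul]; exact L.zero_mem
  neg_mem' := fun {a} ha x hx => by rw [neg_mul]; exact L.neg_mem (ha _ hx)

/-- The lattice `L ⊂ K` has conductor `f`: its ring of multipliers is the order `ℤ + f 𝒪_K`. -/
def HasConductor (L : Submodule ℤ K) (f : ℕ+) : Prop := multiplierRing L = quadraticOrder K f

theorem mem_toComplex_of_eq_span {L : Submodule ℤ K} {τ : K}
    (h : L = Submodule.span ℤ {1, τ}) {x : ℂ} :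
    x ∈ toComplex L ↔ ∃ a b : ℤ, x = a * τ + b := by
  subst h
  constructor
  · rintro ⟨y, hy, rfl⟩
    obtain ⟨b, a, rfl⟩ := Submodule.mem_span_pair.1 hy
    exact ⟨a, b, by simp [add_comm]⟩
  · rintro ⟨a, b, rfl⟩
    exact ⟨b • 1 + a • τ, Submodule.mem_span_pair.2 ⟨b, a, rfl⟩, by simp [add_comm]⟩

theorem exists_of_mem_mul {L₁ L₂ : Submodule ℤ K} {τ₁ : K}
    (h₁ : L₁ = Submodule.span ℤ {1, τ₁}) {x : ℂ}
    (hx : x ∈ toComplex (L₁ * L₂)) :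
    ∃ a ∈ toComplex L₂, ∃ b ∈ toComplex L₂, x = a + b * τ₁ := by
  obtain ⟨y, hy, rfl⟩ := hx
  have hy' : y ∈ L₁ * L₂ := hy
  clear hy
  induction hy' using Submodule.mul_induction_on' with
  | mem_mul_mem l hl m hm =>
    rw [h₁] at hl
    obtain ⟨a, b, rfl⟩ := Submodule.mem_span_pair.1 hl
    refine ⟨_, ⟨a • m, L₂.smul_mem a hm, rfl⟩, _, ⟨b • m, L₂.smul_mem b hm, rfl⟩, ?_⟩
    simp
    ring
  | add x _ y _ hx hy =>
    obtain ⟨a, ha, b, hb, h⟩ := hx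
    obtain ⟨a', ha', b', hb', h'⟩ := hy
    refine ⟨_, Submodule.add_mem _ ha ha', _, Submodule.add_mem _ hb hb', ?_⟩
    rw [map_add, h, h']
    ring

variable [hK : ImaginaryQuadratic K]

instance ImaginaryQuadratic.numberField : NumberField K where
  to_finiteDimensional := FiniteDimensional.of_finrank_pos (by rw [hK.finrank_eq]; norm_num)

theorem im_ne_zero_basis {w : ℂ} (hw : w.im ≠ 0) (z : ℂ) :
    z = ((z.re - z.im / w.im * w.re : ℝ) : ℂ) * 1 + ((z.im / w.im : ℝ) : ℂ) * w := by
  apply Complex.ext <;> simp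
  field_simp

theorem linearIndependent_one_of_im {w : ℂ} (hw : w.im ≠ 0) :
    LinearIndependent ℝ ![(1 : ℂ), w] := by
  rw [LinearIndependent.pair_iff]
  intro s t h
  have h2 := congrArg Complex.im h
  have h1 := congrArg Complex.re h
  simp [hw] at h1 h2
  subst h2
  simpa using h1

theorem ImaginaryQuadratic.exists_basis :
    ∃ w : K, (w : ℂ).im ≠ 0 ∧ ∀ x : K, ∃ a b : ℚ, x = algebraMap ℚ K a + algebraMap ℚ K b * w := by
  obtain ⟨w, hwK, hw⟩ := hK.exists_im_ne_zero
  refine ⟨⟨w, hwK⟩, hw, ?_⟩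
  have hli : LinearIndependent ℚ ![(1 : K), ⟨w, hwK⟩] := by
    rw [LinearIndependent.pair_iff]
    intro s t h
    have h' := congrArg (fun x : K => (x : ℂ)) h
    simp [Algebra.smul_def] at h'
    have h2 := congrArg Complex.im h'
    have h1 := congrArg Complex.re h'
    simp [hw] at h1 h2
    subst h2
    simpa using h1
  have hsp := hli.span_eq_top_of_card_eq_finrank (by simp [hK.finrank_eq])
  intro x
  have hx : x ∈ Submodule.span ℚ (Set.range ![(1 : K), ⟨w, hwK⟩]) := hsp ▸ trivial
  rw [Matrix.range_cons, Matrix.range_cons, Matrix.range_empty, Set.union_empty,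
    Set.singleton_union, Submodule.mem_span_pair] at hx
  obtain ⟨a, b, h⟩ := hx
  exact ⟨a, b, by rw [← h, Algebra.smul_def, Algebra.smul_def, mul_one]⟩

theorem discreteTopology_toComplex (L : Submodule ℤ K) [hL : L.IsLattice ℚ] :
    DiscreteTopology (toComplex L) := by
  obtain ⟨w, hw, hb⟩ := ImaginaryQuadratic.exists_basis (K := K)
  -- a common denominator `d`, with `d L ⊆ ℤ + ℤ w`
  let M : Submodule ℤ ℂ := Submodule.span ℤ (Set.range ![(1 : ℂ), (w : ℂ)])
  have h1 : (1 : ℂ) ∈ M := Submodule.subset_span ⟨0, rfl⟩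
  have h2 : (w : ℂ) ∈ M := Submodule.subset_span ⟨1, rfl⟩
  have den : ∀ x : K, ∃ d : ℕ, d ≠ 0 ∧ d • (x : ℂ) ∈ M := by
    intro x
    obtain ⟨a, b, rfl⟩ := hb x
    refine ⟨a.den * b.den, mul_ne_zero a.den_nz b.den_nz, ?_⟩
    have : (a.den * b.den) • ((algebraMap ℚ K a + algebraMap ℚ K b * w : K) : ℂ) =
        (a.num * b.den) • (1 : ℂ) + (b.num * a.den) • (w : ℂ) := by
      have ha : (a : ℂ) * a.den = a.num := by exact_mod_cast a.mul_den_eq_num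
      have hb : (b : ℂ) * b.den = b.num := by exact_mod_cast b.mul_den_eq_num
      simp
      linear_combination (b.den : ℂ) * ha + (a.den : ℂ) * w * hb
    rw [this]
    exact M.add_mem (M.smul_mem _ h1) (M.smul_mem _ h2)
  obtain ⟨s, hs⟩ := hL.fg
  choose d hd hdM using den
  let D : ℕ := ∏ x ∈ s, d x
  have hD : D ≠ 0 := Finset.prod_ne_zero_iff.2 fun x _ => hd x
  have hDM : ∀ x ∈ toComplex L, D • x ∈ M := by
    rintro _ ⟨x, hx, rfl⟩
    rw [← hs] at hx
    change D • (x : ℂ) ∈ M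
    induction hx using Submodule.span_induction with
    | mem x hx =>
      obtain ⟨c, hc⟩ := Finset.dvd_prod_of_mem d hx
      have : D • (x : ℂ) = c • d x • (x : ℂ) := by
        rw [smul_smul, mul_comm c]
        exact congrArg (· • (x : ℂ)) hc
      rw [this]
      exact M.nsmul_mem (hdM x) c
    | zero => simp
    | add x y _ _ hx hy =>
      have : D • ((x + y : K) : ℂ) = D • (x : ℂ) + D • (y : ℂ) := by
        rw [← smul_add]
        rfl
      exact this ▸ M.add_mem hx hy
    | smul a x _ hx =>
      have : D • ((a • x : K) : ℂ) = a • D • (x : ℂ) := by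
        simp only [nsmul_eq_mul, zsmul_eq_mul]
        push_cast
        ring
      exact this ▸ M.smul_mem a hx
  let b := basisOfLinearIndependentOfCardEqFinrank (linearIndependent_one_of_im hw) (by simp)
  have hM : M = Submodule.span ℤ (Set.range b) := by
    rw [coe_basisOfLinearIndependentOfCardEqFinrank]
  have : DiscreteTopology M := by rw [hM]; infer_instance
  refine DiscreteTopology.of_continuous_injective
    (f := fun x : toComplex L => (⟨D • (x : ℂ), hDM x x.2⟩ : M)) (by fun_prop) ?_
  intro x y hxy
  have h : D • (x : ℂ) = D • (y : ℂ) := congrArg Subtype.val hxy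
  simpa [hD] using h

theorem span_toComplex (L : Submodule ℤ K) [hL : L.IsLattice ℚ] :
    Submodule.span ℝ (toComplex L : Set ℂ) = ⊤ := by
  have key : ∀ x : K, (x : ℂ) ∈ Submodule.span ℝ (toComplex L : Set ℂ) := by
    intro x
    have hx : x ∈ Submodule.span ℚ (L : Set K) := hL.span_eq_top ▸ trivial
    induction hx using Submodule.span_induction with
    | mem x hx => exact Submodule.subset_span ⟨x, hx, rfl⟩
    | zero => simp
    | add x y _ _ hx hy => exact Submodule.add_mem _ hx hy
    | smul a x _ hx =>
      have : ((a • x : K) : ℂ) = (a : ℝ) • (x : ℂ) := by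
        simp [Algebra.smul_def]
      exact this ▸ Submodule.smul_mem _ _ hx
  obtain ⟨w, hw, -⟩ := ImaginaryQuadratic.exists_basis (K := K)
  refine eq_top_iff.2 fun z _ => ?_
  rw [im_ne_zero_basis hw z, ← Complex.real_smul, ← Complex.real_smul]
  exact Submodule.add_mem _ (Submodule.smul_mem _ _ (key 1)) (Submodule.smul_mem _ _ (key w))

/-- The elliptic curve `ℂ / L` attached to a rank one `K`-lattice `L ⊂ K`. Here the rank one
`K`-lattices, i.e. the free abelian subgroups of `K` of rank `2`, are the finitely generated
subgroups of `K` which span `K` over `ℚ`. -/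
noncomputable def ellipticCurve (L : Submodule ℤ K) [L.IsLattice ℚ] : ComplexTorus where
  V := ℂ
  Λ := toComplex L
  discrete := discreteTopology_toComplex L
  span_eq_top := span_toComplex L

/-- The product `L₁L₂` of two rank one `K`-lattices is a rank one `K`-lattice. -/
instance isLattice_mul (L₁ L₂ : Submodule ℤ K) [h₁ : L₁.IsLattice ℚ] [h₂ : L₂.IsLattice ℚ] :
    (L₁ * L₂).IsLattice ℚ where
  fg := h₁.fg.mul h₂.fg
  span_eq_top := by
    obtain ⟨y, hy, hy0⟩ : ∃ y ∈ L₂, y ≠ 0 := by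
      by_contra! h
      have : (L₂ : Set K) ⊆ {0} := fun y hy => h y hy
      have h1 : (1 : K) ∈ Submodule.span ℚ (L₂ : Set K) := h₂.span_eq_top ▸ trivial
      have := Submodule.span_mono (R := ℚ) this h1
      simp at this
    have key : ∀ x : K, x * y ∈ Submodule.span ℚ ((L₁ * L₂ : Submodule ℤ K) : Set K) := by
      intro x
      have hx : x ∈ Submodule.span ℚ (L₁ : Set K) := h₁.span_eq_top ▸ trivial
      induction hx using Submodule.span_induction with
      | mem x hx => exact Submodule.subset_span (Submodule.mul_mem_mul hx hy)
      | zero => simp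
      | add x x' _ _ hx hx' => rw [add_mul]; exact Submodule.add_mem _ hx hx'
      | smul a x _ hx => rw [smul_mul_assoc]; exact Submodule.smul_mem _ _ hx
    refine eq_top_iff.2 fun x _ => ?_
    have := key (x * y⁻¹)
    rwa [inv_mul_cancel_right₀ hy0] at this

instance isLattice_orderLattice (f : ℕ+) : (orderLattice K f).IsLattice ℚ where
  fg := by
    let g : (ℤ × NumberField.RingOfIntegers K) →ₗ[ℤ] K :=
      (Algebra.linearMap ℤ K).coprod
        ((f : ℕ) • (Algebra.linearMap (NumberField.RingOfIntegers K) K).restrictScalars ℤ)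
    have : orderLattice K f = LinearMap.range g := by
      ext x
      constructor
      · rintro ⟨a, y, rfl⟩
        exact ⟨(a, y), by simp [g]⟩
      · rintro ⟨⟨a, y⟩, rfl⟩
        exact ⟨a, y, by simp [g]⟩
    rw [this, LinearMap.range_eq_map]
    exact (Module.Finite.fg_top).map g
  span_eq_top := by
    refine eq_top_iff.2 fun x _ => ?_
    have hx : IsAlgebraic ℤ x :=
      (IsFractionRing.isAlgebraic_iff ℤ ℚ K).2 (IsAlgebraic.of_finite ℚ x)
    obtain ⟨d, hd, hy⟩ := hx.exists_integral_multiple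
    let y : NumberField.RingOfIntegers K := ⟨d • x, hy⟩
    have hy' : (y : K) = d * x := zsmul_eq_mul x d
    have hd' : (d : K) ≠ 0 := Int.cast_ne_zero.2 hd
    have hf : ((f : ℕ) : K) ≠ 0 := Nat.cast_ne_zero.2 f.ne_zero
    have : x = ((d : ℚ)⁻¹ * ((f : ℕ) : ℚ)⁻¹) • (((0 : ℤ) : K) + (f : ℕ) * (y : K)) := by
      rw [hy', Algebra.smul_def]
      simp
      field_simp
    rw [this]
    exact Submodule.smul_mem _ _ (Submodule.subset_span ⟨0, y, rfl⟩)

/-! ### The identification of `ℂ / L₁L₂` with `Ext¹_an(ℂ / L₁, ℂ / L₂)` -/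

theorem im_ne_zero_of_isLattice {L : Submodule ℤ K} [L.IsLattice ℚ] {τ : K}
    (h : L = Submodule.span ℤ {1, τ}) : (τ : ℂ).im ≠ 0 := by
  intro h0
  have hle : Submodule.span ℝ (toComplex L : Set ℂ) ≤ LinearMap.ker Complex.imLm := by
    rw [Submodule.span_le]
    rintro _ ⟨x, hx, rfl⟩
    rw [SetLike.mem_coe, h, Submodule.mem_span_pair] at hx
    obtain ⟨a, b, rfl⟩ := hx
    simp [h0]
  rw [span_toComplex] at hle
  have := hle (x := Complex.I) trivial
  simp at this

/-- The lattice in `ℂ²` generated by the columns of the period matrix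
`(τ₂ 1 z 0; 0 0 τ₁ 1)`. -/
noncomputable def periodLattice (τ₁ τ₂ z : ℂ) : Submodule ℤ (ℂ × ℂ) :=
  Submodule.span ℤ {(τ₂, 0), (1, 0), (z, τ₁), (0, 1)}

theorem mem_periodLattice {τ₁ τ₂ z : ℂ} {v : ℂ × ℂ} :
    v ∈ periodLattice τ₁ τ₂ z ↔
      ∃ a b c d : ℤ, v = (a * τ₂ + b + c * z, c * τ₁ + d) := by
  rw [periodLattice]
  simp only [Submodule.mem_span_insert, Submodule.mem_span_singleton]
  constructor
  · rintro ⟨a, _, ⟨b, _, ⟨c, _, ⟨d, rfl⟩, rfl⟩, rfl⟩, rfl⟩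
    exact ⟨a, b, c, d, by simp [add_assoc]⟩
  · rintro ⟨a, b, c, d, rfl⟩
    exact ⟨a, _, ⟨b, _, ⟨c, _, ⟨d, rfl⟩, rfl⟩, rfl⟩, by simp [add_assoc]⟩

theorem linearIndependent_periods {τ₁ τ₂ : ℂ} (h₁ : τ₁.im ≠ 0) (h₂ : τ₂.im ≠ 0) (z : ℂ) :
    LinearIndependent ℝ ![((τ₂, 0) : ℂ × ℂ), (1, 0), (z, τ₁), (0, 1)] := by
  rw [Fintype.linearIndependent_iff]
  intro g hg
  simp only [Fin.sum_univ_four, Matrix.cons_val, Prod.smul_mk, Prod.mk_add_mk, smul_zero,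
    zero_add, add_zero, Prod.mk_eq_zero, Complex.real_smul, mul_one] at hg
  obtain ⟨ha, hb⟩ := hg
  have hb1 := congrArg Complex.im hb
  have hb2 := congrArg Complex.re hb
  have ha1 := congrArg Complex.im ha
  have ha2 := congrArg Complex.re ha
  simp [h₁] at hb1
  simp [hb1] at hb2
  simp [hb1, h₂] at ha1
  simp [hb1, ha1] at ha2
  intro i
  fin_cases i <;> assumption

/-- The complex torus `S_z = ℂ² / (τ₂ 1 z 0; 0 0 τ₁ 1)`. -/
noncomputable def periodTorus {τ₁ τ₂ : ℂ} (h₁ : τ₁.im ≠ 0) (h₂ : τ₂.im ≠ 0) (z : ℂ) :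
    ComplexTorus where
  V := ℂ × ℂ
  Λ := periodLattice τ₁ τ₂ z
  discrete := by
    let b := basisOfLinearIndependentOfCardEqFinrank (linearIndependent_periods h₁ h₂ z) (by simp)
    have hM : periodLattice τ₁ τ₂ z = Submodule.span ℤ (Set.range b) := by
      rw [coe_basisOfLinearIndependentOfCardEqFinrank, periodLattice]
      congr 1
      simp only [Matrix.range_cons, Matrix.range_empty, Set.union_empty, Set.singleton_union]
    rw [hM]
    infer_instance
  span_eq_top := by
    have h := (linearIndependent_periods h₁ h₂ z).span_eq_top_of_card_eq_finrank (by simp)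
    refine eq_top_iff.2 (h ▸ Submodule.span_mono ?_)
    rintro _ ⟨i, rfl⟩
    fin_cases i <;> exact Submodule.subset_span (by simp)

variable {L₁ L₂ : Submodule ℤ K} [L₁.IsLattice ℚ] [L₂.IsLattice ℚ] {τ₁ τ₂ : K}

/-- The extension `0 → ℂ / L₂ → S_z → ℂ / L₁ → 0` given by `z ∈ ℂ`, where `L₁ = ℤ + ℤ τ₁` and
`L₂ = ℤ + ℤ τ₂`; the two maps are induced by `w ↦ (w, 0)` and `(u, v) ↦ v`. -/
noncomputable def periodExtension (h₁ : L₁ = Submodule.span ℤ {1, τ₁})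
    (h₂ : L₂ = Submodule.span ℤ {1, τ₂}) (z : ℂ) :
    ComplexTorus.Extension (ellipticCurve L₁) (ellipticCurve L₂) where
  S := periodTorus (im_ne_zero_of_isLattice h₁) (im_ne_zero_of_isLattice h₂) z
  i := ComplexTorus.Hom.ofLinear (A := ellipticCurve L₂)
    (B := periodTorus (im_ne_zero_of_isLattice h₁) (im_ne_zero_of_isLattice h₂) z)
    (LinearMap.inl ℂ ℂ ℂ) (by
      intro x hx
      obtain ⟨a, b, rfl⟩ := (mem_toComplex_of_eq_span h₂).1 hx
      refine mem_periodLattice.2 ⟨a, b, 0, 0, Prod.ext ?_ ?_⟩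
      · change (a * τ₂ + b : ℂ) = _
        simp
      · change (0 : ℂ) = _
        simp)
  p := ComplexTorus.Hom.ofLinear
    (A := periodTorus (im_ne_zero_of_isLattice h₁) (im_ne_zero_of_isLattice h₂) z)
    (B := ellipticCurve L₁) (LinearMap.snd ℂ ℂ ℂ) (by
      intro x hx
      obtain ⟨a, b, c, d, rfl⟩ := mem_periodLattice.1 hx
      exact (mem_toComplex_of_eq_span h₁).2 ⟨c, d, rfl⟩)
  injective := by
    refine (injective_iff_map_eq_zero (ComplexTorus.Hom.toAddMonoidHom
      (ComplexTorus.Hom.ofLinear (A := ellipticCurve L₂)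
        (B := periodTorus (im_ne_zero_of_isLattice h₁) (im_ne_zero_of_isLattice h₂) z)
        (LinearMap.inl ℂ ℂ ℂ) _))).2 fun x hx => ?_
    obtain ⟨x, rfl⟩ := Submodule.mkQ_surjective _ x
    obtain ⟨a, b, c, d, h⟩ := mem_periodLattice.1 ((Submodule.Quotient.mk_eq_zero _).1 hx)
    have h3 : (id x : ℂ) = (a : ℂ) * (τ₂ : ℂ) + (b : ℂ) + (c : ℂ) * z := congrArg Prod.fst h
    have h4 : (0 : ℂ) = c * τ₁ + d := congrArg Prod.snd h
    have hc : (c : ℝ) = 0 := by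
      have := congrArg Complex.im h4
      simpa [im_ne_zero_of_isLattice h₁] using this
    refine (Submodule.Quotient.mk_eq_zero _).2 ((mem_toComplex_of_eq_span h₂).2 ⟨a, b, ?_⟩)
    have hc' : c = 0 := by exact_mod_cast hc
    rw [hc', Int.cast_zero, zero_mul, add_zero] at h3
    exact h3
  exact := by
    intro s
    constructor
    · obtain ⟨⟨u, v⟩, rfl⟩ := Submodule.mkQ_surjective _ s
      intro hs
      obtain ⟨c, d, h⟩ :=
        (mem_toComplex_of_eq_span h₁).1 ((Submodule.Quotient.mk_eq_zero _).1 hs)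
      refine ⟨(ellipticCurve L₂).proj ((u : ℂ) - (c : ℂ) * z : ℂ), ?_⟩
      refine (Submodule.Quotient.eq _).2 (mem_periodLattice.2 ⟨0, 0, -c, -d, ?_⟩)
      have h' : v = c * τ₁ + d := h
      refine Prod.ext ?_ ?_
      · change u - c * z - u = _
        simp
      · change 0 - v = _
        rw [h']
        push_cast
        ring
    · rintro ⟨x, rfl⟩
      obtain ⟨x, rfl⟩ := Submodule.mkQ_surjective _ x
      rfl
  surjective := by
    intro x
    obtain ⟨x, rfl⟩ := Submodule.mkQ_surjective _ x
    exact ⟨(periodTorus (im_ne_zero_of_isLattice h₁) (im_ne_zero_of_isLattice h₂) z).proj (0, x),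
      rfl⟩

/-- The linear automorphism `(u, v) ↦ (u - c v, v)` of `ℂ²`. -/
noncomputable def shear (c : ℂ) : (ℂ × ℂ) ≃ₗ[ℂ] (ℂ × ℂ) where
  toFun v := (v.1 - c * v.2, v.2)
  invFun v := (v.1 + c * v.2, v.2)
  map_add' v w := by ext <;> simp; ring
  map_smul' a v := by ext <;> simp; ring
  left_inv v := by simp
  right_inv v := by simp

theorem shear_mem_periodLattice {τ₁ τ₂ z z' : ℂ} {x₁ x₂ y₁ y₂ : ℤ}
    (h : z - z' = x₁ * τ₂ + x₂ + (y₁ * τ₂ + y₂) * τ₁) {v : ℂ × ℂ}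
    (hv : v ∈ periodLattice τ₁ τ₂ z) : shear (y₁ * τ₂ + y₂) v ∈ periodLattice τ₁ τ₂ z' := by
  obtain ⟨a, b, c, d, rfl⟩ := mem_periodLattice.1 hv
  refine mem_periodLattice.2 ⟨a + c * x₁ - d * y₁, b + c * x₂ - d * y₂, c, d, ?_⟩
  simp only [shear, LinearEquiv.coe_mk, LinearMap.coe_mk, AddHom.coe_mk, Prod.mk.injEq, and_true]
  push_cast
  linear_combination (c : ℂ) * h

theorem shear_symm_mem_periodLattice {τ₁ τ₂ z z' : ℂ} {x₁ x₂ y₁ y₂ : ℤ}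
    (h : z - z' = x₁ * τ₂ + x₂ + (y₁ * τ₂ + y₂) * τ₁) {v : ℂ × ℂ}
    (hv : v ∈ periodLattice τ₁ τ₂ z') :
    (shear (y₁ * τ₂ + y₂)).symm v ∈ periodLattice τ₁ τ₂ z := by
  obtain ⟨a, b, c, d, rfl⟩ := mem_periodLattice.1 hv
  refine mem_periodLattice.2 ⟨a - c * x₁ + d * y₁, b - c * x₂ + d * y₂, c, d, ?_⟩
  simp only [shear, LinearEquiv.coe_symm_mk', Prod.mk.injEq, and_true]
  push_cast
  linear_combination (-c : ℂ) * h

theorem shear_inl (c w : ℂ) : shear c (w, 0) = (w, 0) := by simp [shear]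

theorem shear_snd (c : ℂ) (v : ℂ × ℂ) : (shear c v).2 = v.2 := rfl

theorem periodExtension_cls_eq (h₁ : L₁ = Submodule.span ℤ {1, τ₁})
    (h₂ : L₂ = Submodule.span ℤ {1, τ₂}) {z z' : ℂ} (h : z - z' ∈ toComplex (L₁ * L₂)) :
    (periodExtension h₁ h₂ z).cls = (periodExtension h₁ h₂ z').cls := by
  obtain ⟨x, hx, y, hy, hxy⟩ := exists_of_mem_mul h₁ h
  obtain ⟨x₁, x₂, rfl⟩ := (mem_toComplex_of_eq_span h₂).1 hx
  obtain ⟨y₁, y₂, rfl⟩ := (mem_toComplex_of_eq_span h₂).1 hy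
  refine Quotient.sound ⟨ComplexTorus.Iso.ofLinear
    (A := periodTorus (im_ne_zero_of_isLattice h₁) (im_ne_zero_of_isLattice h₂) z)
    (B := periodTorus (im_ne_zero_of_isLattice h₁) (im_ne_zero_of_isLattice h₂) z')
    (shear (y₁ * τ₂ + y₂)) (fun v hv => shear_mem_periodLattice hxy hv)
    (fun v hv => shear_symm_mem_periodLattice hxy hv), ?_, ?_⟩
  · intro w
    obtain ⟨w, rfl⟩ := Submodule.mkQ_surjective _ w
    exact congrArg (periodLattice τ₁ τ₂ z').mkQ (shear_inl _ w)
  · intro s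
    obtain ⟨s, rfl⟩ := Submodule.mkQ_surjective _ s
    exact congrArg (toComplex L₁).mkQ (shear_snd (y₁ * τ₂ + y₂) s)

/-- The map `ℂ / L₁L₂ → Ext¹_an(ℂ / L₁, ℂ / L₂)` which sends the class of `z` to the class of the
extension `0 → ℂ / L₂ → S_z → ℂ / L₁ → 0`. -/
noncomputable def toExt (h₁ : L₁ = Submodule.span ℤ {1, τ₁})
    (h₂ : L₂ = Submodule.span ℤ {1, τ₂}) :
    (ellipticCurve (L₁ * L₂)).Pts →
      ComplexTorus.Ext1an (ellipticCurve L₁) (ellipticCurve L₂) :=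
  Quotient.lift (fun z : ℂ => (periodExtension h₁ h₂ z).cls) fun _ _ h =>
    periodExtension_cls_eq h₁ h₂ ((Submodule.quotientRel_def _).1 h)

end Lattices

/-!
Let `P` be the class of `z`. As `n z ∈ L₁ L₂`, the number `z` lies in `K`, and the extension is, up
to equivalence, `ℂ² / Λ` for the lattice `Λ ⊂ K²` spanned by `(τ₂, 0)`, `(1, 0)`, `(z, τ₁)`,
`(0, 1)`. It has to be shown that `Λ` is isomorphic, by a `K`-linear map of determinant one, to
`𝒪 ⊕ M` with `𝒪 = 𝒪_{n lcm(f₁, f₂)}` and `M = L₁ L₂ + ℤ z`. The group `M` is generated by the determinants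
`det (x, y)` with `x, y ∈ Λ`, which is what makes it the complement of `𝒪`.

* The ring of multipliers of `Λ` is exactly `𝒪` (`smul_mem_fieldPeriodLattice`,
  `exists_eq_of_smul_mem_fieldPeriodLattice`). If `α Λ ⊆ Λ`, then the matrix of `α` on the basis
  `τ₁, 1` is scalar modulo `n`, so `α = b + n β` with `b ∈ ℤ` and `β L₁ ⊆ L₁`. To see that also
  `β L₂ ⊆ L₂`, the prime factors of `n` are removed one at a time from the multiplier `n β` of `L₂`,
  by `mem_multiplierRing_of_prime_mul`; this uses that `z` has exact order `n`.
* Write `𝒪 = ℤ[Ω]`. By the previous point `Ω` is not a scalar on `Λ / p Λ` for any prime `p`, so for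
  each `p` there is a vector independent of its multiple by `Ω` modulo `p`. The exact sequence
  `0 → L₂ → Λ → L₁ → 0` reduces the choice of one vector `v` for all primes to two applications of
  the Chinese remainder theorem (`exists_forall_indepMod`).
* For such a `v` there is a functional `ℓ : Λ → ℤ` with `ℓ v = 0` and `ℓ (Ω v) = 1`
  (`exists_functional_of_forall_indepMod`). It is the `Ω`-coordinate of an `𝒪`-linear map `Λ → 𝒪`
  with `v ↦ 1` (`exists_splitting`), which together with `x ↦ det (v, x)` gives the coordinates in
  question; the Plücker relation shows that `det (v, Λ)` is all of `M`
  (`exists_fieldPeriodLattice_iff`).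
-/

/-! ### Vectors independent of their image modulo every prime -/

section CyclicVectors

open scoped Pointwise

variable {G G₁ : Type*} [AddCommGroup G] [AddCommGroup G₁]

/-- `v` and `φ v` are linearly independent modulo `p`. -/
def IndepMod (φ : Module.End ℤ G) (p : ℕ) (v : G) : Prop :=
  ∀ s t : ℤ, s • v + t • φ v ∈ (p : ℤ) • (⊤ : Submodule ℤ G) → (p : ℤ) ∣ s ∧ (p : ℤ) ∣ t

theorem smul_mem_smul_top (p : ℤ) (x : G) : p • x ∈ p • (⊤ : Submodule ℤ G) :=
  Submodule.smul_mem_pointwise_smul x p ⊤ trivial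

theorem mem_smul_top_iff {p : ℤ} {x : G} :
    x ∈ p • (⊤ : Submodule ℤ G) ↔ ∃ y, p • y = x := by
  simp [Submodule.mem_smul_pointwise_iff_exists]

theorem map_mem_smul_top (f : G →ₗ[ℤ] G₁) {p : ℤ} {x : G} (hx : x ∈ p • (⊤ : Submodule ℤ G)) :
    f x ∈ p • (⊤ : Submodule ℤ G₁) := by
  obtain ⟨y, rfl⟩ := mem_smul_top_iff.1 hx
  rw [map_smul]
  exact smul_mem_smul_top p _

theorem mem_smul_top_of_dvd {p c : ℤ} (h : p ∣ c) (x : G) : c • x ∈ p • (⊤ : Submodule ℤ G) := by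
  obtain ⟨d, rfl⟩ := h
  rw [mul_smul]
  exact smul_mem_smul_top p _

/-- Any multiple prime to `p` can be cancelled modulo `p`. -/
theorem mem_smul_top_of_smul {p : ℕ} (hp : p.Prime) {c : ℤ} (hc : ¬ (p : ℤ) ∣ c) {x : G}
    (h : c • x ∈ (p : ℤ) • (⊤ : Submodule ℤ G)) : x ∈ (p : ℤ) • (⊤ : Submodule ℤ G) := by
  have hco : IsCoprime (p : ℤ) c := ((Nat.prime_iff_prime_int.1 hp).coprime_iff_not_dvd).2 hc
  obtain ⟨a, b, hab⟩ := hco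
  have : x = a • (p : ℤ) • x + b • c • x := by
    rw [smul_smul, smul_smul, ← add_smul, hab, one_smul]
  rw [this]
  exact Submodule.add_mem _ (Submodule.smul_mem _ _ (smul_mem_smul_top _ _))
    (Submodule.smul_mem _ _ h)

theorem mem_smul_top_of_forall_dvd {ι : Type*} (b : Module.Basis ι ℤ G) {p : ℤ} {x : G}
    (h : ∀ i, p ∣ b.repr x i) : x ∈ p • (⊤ : Submodule ℤ G) := by
  refine mem_smul_top_iff.2 ⟨b.repr.symm ((b.repr x).mapRange (· / p) (Int.zero_ediv p)), ?_⟩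
  refine b.ext_elem fun i => ?_
  simpa using Int.mul_ediv_cancel' (h i)

theorem dvd_of_smul_mem {p : ℕ} (hp : p.Prime) {c : ℤ} {x : G}
    (hx : x ∉ (p : ℤ) • (⊤ : Submodule ℤ G)) (h : c • x ∈ (p : ℤ) • (⊤ : Submodule ℤ G)) :
    (p : ℤ) ∣ c := by
  by_contra hc
  exact hx (mem_smul_top_of_smul hp hc h)

/-- The Chinese remainder theorem in an abelian group. -/
theorem exists_forall_sub_mem_smul_top (S : Finset ℕ) (hS : ∀ p ∈ S, p.Prime) (x : ℕ → G) :
    ∃ y : G, ∀ p ∈ S, y - x p ∈ (p : ℤ) • (⊤ : Submodule ℤ G) := by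
  induction S using Finset.induction_on with
  | empty => exact ⟨0, by simp⟩
  | insert p S hpS ih =>
    obtain ⟨y, hy⟩ := ih fun q hq => hS q (Finset.mem_insert_of_mem hq)
    have hp := hS p (Finset.mem_insert_self p S)
    have hco : Nat.Coprime (∏ q ∈ S, q) p := by
      refine Nat.Coprime.prod_left fun q hq => ?_
      refine (Nat.coprime_primes (hS q (Finset.mem_insert_of_mem hq)) hp).2 ?_
      rintro rfl
      exact hpS hq
    obtain ⟨a, b, hab⟩ := Nat.isCoprime_iff_coprime.2 hco
    refine ⟨y + (a * (∏ q ∈ S, q : ℕ)) • (x p - y), fun q hq => ?_⟩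
    rcases Finset.mem_insert.1 hq with rfl | hq
    · have : y + (a * (∏ q ∈ S, q : ℕ)) • (x q - y) - x q = (b * (q : ℤ)) • (y - x q) := by
        rw [← sub_eq_of_eq_add' hab.symm]
        module
      rw [this]
      exact mem_smul_top_of_dvd (Dvd.intro_left b rfl) _
    · have h1 : (q : ℤ) ∣ a * (∏ q ∈ S, q : ℕ) :=
        Dvd.dvd.mul_left (Int.natCast_dvd_natCast.2 (Finset.dvd_prod_of_mem _ hq)) a
      rw [add_sub_right_comm]
      exact Submodule.add_mem _ (hy q hq) (mem_smul_top_of_dvd h1 _)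

theorem IndepMod.congr {φ : Module.End ℤ G} {p : ℕ} {v w : G} (hv : IndepMod φ p v)
    (h : w - v ∈ (p : ℤ) • (⊤ : Submodule ℤ G)) : IndepMod φ p w := by
  intro s t hst
  refine hv s t ?_
  have : s • v + t • φ v = s • w + t • φ w - (s • (w - v) + t • φ (w - v)) := by
    rw [map_sub]
    module
  rw [this]
  exact Submodule.sub_mem _ hst (Submodule.add_mem _ (Submodule.smul_mem _ _ h)
    (Submodule.smul_mem _ _ (map_mem_smul_top φ h)))

theorem IndepMod.of_map {φ : Module.End ℤ G} {φ₁ : Module.End ℤ G₁} {π : G →ₗ[ℤ] G₁}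
    (hπ : ∀ x, π (φ x) = φ₁ (π x)) {p : ℕ} {v : G} (hv : IndepMod φ₁ p (π v)) :
    IndepMod φ p v := by
  intro s t hst
  refine hv s t ?_
  have := map_mem_smul_top π hst
  rwa [map_add, map_smul, map_smul, hπ] at this

/-- A vector which is nonzero modulo `p` and not independent of its image is an eigenvector
modulo `p`. -/
theorem exists_eigenvalue_of_not_indepMod {φ : Module.End ℤ G} {p : ℕ} (hp : p.Prime) {v : G}
    (hv : v ∉ (p : ℤ) • (⊤ : Submodule ℤ G)) (h : ¬ IndepMod φ p v) :
    ∃ a : ℤ, φ v - a • v ∈ (p : ℤ) • (⊤ : Submodule ℤ G) := by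
  unfold IndepMod at h
  push Not at h
  obtain ⟨s, t, hst, hn⟩ := h
  have ht : ¬ (p : ℤ) ∣ t := fun ht => hn
    (dvd_of_smul_mem hp hv ((Submodule.add_mem_iff_left _ (mem_smul_top_of_dvd ht _)).1 hst)) ht
  obtain ⟨a, b, hab⟩ := ((Nat.prime_iff_prime_int.1 hp).coprime_iff_not_dvd).2 ht
  refine ⟨-(b * s), ?_⟩
  have : φ v - (-(b * s)) • v = (a * p) • φ v + b • (s • v + t • φ v) := by
    have h1 : φ v = (a * p + b * t) • φ v := by rw [hab, one_smul]
    nth_rewrite 1 [h1]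
    module
  rw [this]
  exact Submodule.add_mem _ (mem_smul_top_of_dvd (Dvd.intro_left a rfl) _)
    (Submodule.smul_mem _ _ hst)

/-- An endomorphism of a free abelian group which is not a scalar modulo `p` has a vector which is
independent of its image modulo `p`. -/
theorem exists_indepMod [Module.Free ℤ G] {φ : Module.End ℤ G} {p : ℕ} (hp : p.Prime)
    (h : ∀ a : ℤ, ∃ x, φ x - a • x ∉ (p : ℤ) • (⊤ : Submodule ℤ G)) :
    ∃ v, IndepMod φ p v := by
  by_contra! hbad
  let b := Module.Free.chooseBasis ℤ G
  have hp1 : ¬ (p : ℤ) ∣ 1 := (Nat.prime_iff_prime_int.1 hp).not_dvd_one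
  have coord {x : G} (hx : x ∈ (p : ℤ) • (⊤ : Submodule ℤ G)) (i) : (p : ℤ) ∣ b.repr x i := by
    obtain ⟨y, rfl⟩ := mem_smul_top_iff.1 hx
    simp
  have hb : ∀ i, b i ∉ (p : ℤ) • (⊤ : Submodule ℤ G) := fun i hi => hp1 (by
    simpa using coord hi i)
  choose a ha using fun i => exists_eigenvalue_of_not_indepMod hp (hb i) (hbad (b i))
  -- comparing the eigenvalues of `b i`, `b j` and `b i + b j` shows that they agree
  have hij : ∀ i j, (p : ℤ) ∣ a i - a j := by
    intro i j
    by_cases hne : i = j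
    · simp [hne]
    have hsum : b i + b j ∉ (p : ℤ) • (⊤ : Submodule ℤ G) := fun h => hp1 (by
      simpa [Finsupp.single_apply, hne, Ne.symm hne] using coord h i)
    obtain ⟨c, hc⟩ := exists_eigenvalue_of_not_indepMod hp hsum (hbad _)
    have h1 : (a i - c) • b i + (a j - c) • b j ∈ (p : ℤ) • (⊤ : Submodule ℤ G) := by
      have := Submodule.sub_mem _ hc (Submodule.add_mem _ (ha i) (ha j))
      convert this using 1
      rw [map_add]
      module
    have hi := coord h1 i
    have hj := coord h1 j
    simp [hne, Ne.symm hne] at hi hj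
    have := dvd_sub hi hj
    rwa [sub_sub_sub_cancel_right] at this
  rcases isEmpty_or_nonempty (Module.Free.ChooseBasisIndex ℤ G) with he | ⟨⟨i₀⟩⟩
  · obtain ⟨x, hx⟩ := h 0
    have : φ x - (0 : ℤ) • x = 0 := b.ext_elem fun i => he.elim i
    exact hx (this ▸ Submodule.zero_mem _)
  · obtain ⟨x, hx⟩ := h (a i₀)
    refine hx ?_
    have hx' : x ∈ Submodule.span ℤ (Set.range b) := b.span_eq ▸ trivial
    clear hx
    induction hx' using Submodule.span_induction with
    | mem x hx =>
      obtain ⟨i, rfl⟩ := hx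
      have := Submodule.add_mem _ (ha i) (mem_smul_top_of_dvd (hij i i₀) (b i))
      convert this using 1
      module
    | zero => simp
    | add x y _ _ hx hy =>
      convert Submodule.add_mem _ hx hy using 1
      rw [map_add]
      module
    | smul c x _ hx =>
      convert Submodule.smul_mem _ c hx using 1
      rw [map_smul]
      module

/-- Let `e ∈ ker π` be independent of its image modulo `p`, and let `v` be arbitrary. Then `v` can
be moved within its coset of `ker π` to a vector which is independent of its image modulo `p`. -/
theorem exists_indepMod_add {φ : Module.End ℤ G} {π : G →ₗ[ℤ] G₁} (hπs : Function.Surjective π)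
    (hφ : ∀ x, π x = 0 → π (φ x) = 0)
    {p : ℕ} (hp : p.Prime) {e : G} (he : π e = 0) (hei : IndepMod φ p e) (v : G) :
    ∃ u ∈ LinearMap.ker π, IndepMod φ p (v + u) := by
  by_cases hv : π v ∈ (p : ℤ) • (⊤ : Submodule ℤ G₁)
  · obtain ⟨y, hy⟩ := mem_smul_top_iff.1 hv
    obtain ⟨y, rfl⟩ := hπs y
    refine ⟨e - (v - (p : ℤ) • y), ?_, hei.congr ?_⟩
    · simp [he, ← hy]
    · convert smul_mem_smul_top (p : ℤ) y using 1
      abel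
  by_cases hvi : IndepMod φ p v
  · exact ⟨0, Submodule.zero_mem _, by rwa [add_zero]⟩
  have hv0 : v ∉ (p : ℤ) • (⊤ : Submodule ℤ G) := fun h => hv (map_mem_smul_top π h)
  obtain ⟨a, ha⟩ := exists_eigenvalue_of_not_indepMod hp hv0 hvi
  refine ⟨e, he, fun s t hst => ?_⟩
  have h1 : (s + t * a) • v + (s • e + t • φ e) ∈ (p : ℤ) • (⊤ : Submodule ℤ G) := by
    convert Submodule.sub_mem _ hst (Submodule.smul_mem _ t ha) using 1
    rw [map_add]
    module
  have h2 : (p : ℤ) ∣ s + t * a := by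
    refine dvd_of_smul_mem hp hv ?_
    simpa [he, hφ e he] using map_mem_smul_top π h1
  exact hei s t ((Submodule.add_mem_iff_right _ (mem_smul_top_of_dvd h2 v)).1 h1)

/-- Existence of a vector independent of its image modulo every prime: such vectors exist modulo
each prime, and the fibration `π` confines the conditions to finitely many primes. -/
theorem exists_forall_indepMod [Module.Free ℤ G] [Module.IsTorsionFree ℤ G₁]
    {φ : Module.End ℤ G} {φ₁ : Module.End ℤ G₁}
    {π : G →ₗ[ℤ] G₁} (hπs : Function.Surjective π) (hπ : ∀ x, π (φ x) = φ₁ (π x))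
    (hscalar : ∀ p : ℕ, p.Prime → ∀ a : ℤ, ∃ x, φ x - a • x ∉ (p : ℤ) • (⊤ : Submodule ℤ G))
    {e : G} (he : π e = 0) {k : ℕ} (hk : k ≠ 0)
    (hei : ∀ p : ℕ, p.Prime → ¬ p ∣ k → IndepMod φ p e)
    (hG₁ : ∀ y : G₁, y ≠ 0 → ∃ l : ℕ, l ≠ 0 ∧ ∀ p : ℕ, p.Prime → ¬ p ∣ l → IndepMod φ₁ p y)
    (hne : ∃ y : G₁, y ≠ 0) :
    ∃ v, ∀ p : ℕ, p.Prime → IndepMod φ p v := by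
  have hex : ∀ p : ℕ, ∃ v, p.Prime → IndepMod φ p v := fun p => by
    by_cases hp : p.Prime
    · obtain ⟨v, hv⟩ := exists_indepMod hp (hscalar p hp)
      exact ⟨v, fun _ => hv⟩
    · exact ⟨0, fun h => (hp h).elim⟩
  choose x hx using hex
  -- `v` takes care of the primes at which `e` does not help
  obtain ⟨v, hv, hv0⟩ : ∃ v, (∀ p : ℕ, p.Prime → p ∣ k → IndepMod φ p v) ∧ π v ≠ 0 := by
    obtain ⟨v, hv⟩ := exists_forall_sub_mem_smul_top k.primeFactors
      (fun p hp => Nat.prime_of_mem_primeFactors hp) x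
    have hv' : ∀ p : ℕ, p.Prime → p ∣ k → IndepMod φ p v := fun p hp hpk =>
      (hx p hp).congr (hv p (Nat.mem_primeFactors.2 ⟨hp, hpk, hk⟩))
    by_cases h0 : π v = 0
    · obtain ⟨y, hy⟩ := hne
      obtain ⟨y, rfl⟩ := hπs y
      refine ⟨v + (k : ℤ) • y, fun p hp hpk => (hv' p hp hpk).congr ?_, ?_⟩
      · rw [add_sub_cancel_left]
        exact mem_smul_top_of_dvd (Int.natCast_dvd_natCast.2 hpk) y
      · rw [map_add, h0, zero_add, map_smul]
        exact smul_ne_zero (Int.natCast_ne_zero.2 hk) hy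
    · exact ⟨v, hv', h0⟩
  obtain ⟨l, hl, hli⟩ := hG₁ (π v) hv0
  -- only the primes dividing `l` remain; there `v` is moved within its coset of `ker π`
  have hu : ∀ p : ℕ, ∃ u : LinearMap.ker π, p.Prime → IndepMod φ p (v + u) := fun p => by
    by_cases hp : p.Prime
    · by_cases hpk : p ∣ k
      · exact ⟨0, fun _ => by simpa using hv p hp hpk⟩
      · obtain ⟨u, hu, hui⟩ := exists_indepMod_add (φ := φ) hπs
          (fun x h => by rw [hπ, h, map_zero]) hp he (hei p hp hpk) v
        exact ⟨⟨u, hu⟩, fun _ => hui⟩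
    · exact ⟨0, fun h => (hp h).elim⟩
  choose u hu using hu
  obtain ⟨w, hw⟩ := exists_forall_sub_mem_smul_top l.primeFactors
    (fun p hp => Nat.prime_of_mem_primeFactors hp) u
  refine ⟨v + w, fun p hp => ?_⟩
  by_cases hpl : p ∣ l
  · refine (hu p hp).congr ?_
    have := map_mem_smul_top (LinearMap.ker π).subtype (hw p (Nat.mem_primeFactors.2 ⟨hp, hpl, hl⟩))
    rw [add_sub_add_left_eq_sub]
    exact this
  · refine IndepMod.of_map hπ ?_
    have : π (v + w) = π v := by rw [map_add, LinearMap.mem_ker.1 w.2, add_zero]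
    rw [this]
    exact hli p hp hpl

/-- If `v` and `φ v` are independent modulo every prime, then their `2 × 2` minors generate the unit
ideal. Contracting with `v` an alternating form which takes the value `1` on `(v, φ v)` gives a
functional with the values `0` at `v` and `1` at `φ v`. -/
theorem exists_functional_of_forall_indepMod [Module.Free ℤ G]
    {φ : Module.End ℤ G} {v : G} (hv : ∀ p : ℕ, p.Prime → IndepMod φ p v) :
    ∃ ℓ : G →ₗ[ℤ] ℤ, ℓ v = 0 ∧ ℓ (φ v) = 1 := by
  let I : Ideal ℤ :=
    { carrier := {m | ∃ ℓ : G →ₗ[ℤ] ℤ, ℓ v = 0 ∧ ℓ (φ v) = m}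
      add_mem' := by
        rintro _ _ ⟨ℓ, h, rfl⟩ ⟨ℓ', h', rfl⟩
        exact ⟨ℓ + ℓ', by simp [h, h'], rfl⟩
      zero_mem' := ⟨0, rfl, rfl⟩
      smul_mem' := by
        rintro c _ ⟨ℓ, h, rfl⟩
        exact ⟨c • ℓ, by simp [h], rfl⟩ }
  suffices hI : I = ⊤ from (hI ▸ trivial : (1 : ℤ) ∈ I)
  by_contra hI
  obtain ⟨m, hm⟩ : ∃ m, I = Ideal.span {m} := ⟨_, (Ideal.span_singleton_generator I).symm⟩
  obtain ⟨p, hp, hpm⟩ : ∃ p : ℕ, p.Prime ∧ p ∣ m.natAbs := by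
    refine Nat.exists_prime_and_dvd fun h => hI ?_
    rw [hm, Ideal.span_singleton_eq_top]
    exact Int.isUnit_iff_natAbs_eq.2 h
  have hpI : ∀ ℓ : G →ₗ[ℤ] ℤ, ℓ v = 0 → (p : ℤ) ∣ ℓ (φ v) := fun ℓ h => by
    have : ℓ (φ v) ∈ I := ⟨ℓ, h, rfl⟩
    rw [hm, Ideal.mem_span_singleton] at this
    exact (Int.natCast_dvd.2 hpm).trans this
  let b := Module.Free.chooseBasis ℤ G
  have hminor : ∀ i, b.coord i v • φ v - b.coord i (φ v) • v ∈ (p : ℤ) • (⊤ : Submodule ℤ G) := by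
    refine fun i => mem_smul_top_of_forall_dvd b fun j => ?_
    have := hpI (b.coord i v • b.coord j - b.coord j v • b.coord i) (by simp [mul_comm])
    simpa [mul_comm] using this
  have hvp : v ∈ (p : ℤ) • (⊤ : Submodule ℤ G) := by
    refine mem_smul_top_of_forall_dvd b fun i => ?_
    refine (hv p hp (-(b.coord i (φ v))) (b.coord i v) ?_).2
    convert hminor i using 1
    module
  have h1 := (hv p hp 1 0 (by simpa using hvp)).1
  exact (Nat.prime_iff_prime_int.1 hp).not_dvd_one h1

end CyclicVectors

/-! ### Multipliers of the period lattice -/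

section PeriodLattices

variable {K : IntermediateField ℚ ℂ} {L₁ L₂ : Submodule ℤ K} {τ₁ τ₂ z : K}

/-- `1` and `τ` are linearly independent over `ℤ`. -/
def IndepOne (τ : K) : Prop := ∀ a b : ℤ, (a : K) * τ + b = 0 → a = 0 ∧ b = 0

theorem indepOne_of_im_ne_zero {τ : K} (hτ : (τ : ℂ).im ≠ 0) : IndepOne τ := by
  intro a b h
  have h' : (a : ℂ) * (τ : ℂ) + b = 0 := by exact_mod_cast congrArg (fun x : K => (x : ℂ)) h
  have ha : a = 0 := by
    have := congrArg Complex.im h'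
    simpa [hτ] using this
  subst ha
  simpa using h

theorem IndepOne.eq {τ : K} (hτ : IndepOne τ) {a b a' b' : ℤ}
    (h : (a : K) * τ + b = a' * τ + b') : a = a' ∧ b = b' := by
  obtain ⟨h1, h2⟩ := hτ (a - a') (b - b') (by push_cast; linear_combination h)
  exact ⟨sub_eq_zero.1 h1, sub_eq_zero.1 h2⟩

theorem mem_iff_of_eq_span {L : Submodule ℤ K} {τ : K} (h : L = Submodule.span ℤ {1, τ}) {x : K} :
    x ∈ L ↔ ∃ a b : ℤ, x = a * τ + b := by
  rw [h, Submodule.mem_span_pair]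
  constructor
  · rintro ⟨b, a, rfl⟩
    exact ⟨a, b, by simp [add_comm]⟩
  · rintro ⟨a, b, rfl⟩
    exact ⟨b, a, by simp [add_comm]⟩

theorem int_mul_mem (L : Submodule ℤ K) {x : K} (hx : x ∈ L) (a : ℤ) : (a : K) * x ∈ L := by
  rw [← zsmul_eq_mul]
  exact L.smul_mem a hx

theorem one_mem_of_eq_span {L : Submodule ℤ K} {τ : K} (h : L = Submodule.span ℤ {1, τ}) :
    (1 : K) ∈ L := h ▸ Submodule.subset_span (by simp)

theorem gen_mem_of_eq_span {L : Submodule ℤ K} {τ : K} (h : L = Submodule.span ℤ {1, τ}) :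
    τ ∈ L := h ▸ Submodule.subset_span (by simp)

theorem mem_mul_iff_of_eq_span (h₁ : L₁ = Submodule.span ℤ {1, τ₁}) {x : K} :
    x ∈ L₁ * L₂ ↔ ∃ l ∈ L₂, ∃ l' ∈ L₂, x = l + l' * τ₁ := by
  constructor
  · intro hx
    obtain ⟨_, ⟨l, hl, rfl⟩, _, ⟨l', hl', rfl⟩, h⟩ :=
      exists_of_mem_mul h₁ (mem_toComplex.2 hx)
    exact ⟨l, hl, l', hl', Subtype.ext h⟩
  · rintro ⟨l, hl, l', hl', rfl⟩
    refine Submodule.add_mem _ ?_ ?_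
    · simpa using Submodule.mul_mem_mul (one_mem_of_eq_span h₁) hl
    · rw [mul_comm l']
      exact Submodule.mul_mem_mul (gen_mem_of_eq_span h₁) hl'

theorem mem_multiplierRing {L : Submodule ℤ K} {α : K} :
    α ∈ multiplierRing L ↔ ∀ x ∈ L, α * x ∈ L := Iff.rfl

/-- A multiplier acts on the basis `τ, 1` of its lattice by an integral matrix. -/
theorem exists_matrix_of_mem_multiplierRing {L : Submodule ℤ K} {τ : K}
    (h : L = Submodule.span ℤ {1, τ}) {α : K} (hα : α ∈ multiplierRing L) :
    ∃ a b c d : ℤ, α = a * τ + b ∧ α * τ = c * τ + d := by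
  obtain ⟨a, b, hab⟩ := (mem_iff_of_eq_span h).1 (hα 1 (one_mem_of_eq_span h))
  obtain ⟨c, d, hcd⟩ := (mem_iff_of_eq_span h).1 (hα τ (gen_mem_of_eq_span h))
  exact ⟨a, b, c, d, by rwa [mul_one] at hab, hcd⟩

theorem mem_multiplierRing_of_matrix {L : Submodule ℤ K} {τ : K}
    (h : L = Submodule.span ℤ {1, τ}) {α : K} {a b c d : ℤ} (h1 : α = a * τ + b)
    (h2 : α * τ = c * τ + d) : α ∈ multiplierRing L := by
  intro x hx
  obtain ⟨s, t, rfl⟩ := (mem_iff_of_eq_span h).1 hx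
  refine (mem_iff_of_eq_span h).2 ⟨s * c + t * a, s * d + t * b, ?_⟩
  push_cast
  linear_combination (s : K) * h2 + (t : K) * h1

/-- Cancellation of coprime integral factors. -/
theorem mem_of_coprime {L : Submodule ℤ K} {x : K} {a b : ℤ} (hab : IsCoprime a b)
    (ha : (a : K) * x ∈ L) (hb : (b : K) * x ∈ L) : x ∈ L := by
  obtain ⟨s, t, hst⟩ := hab
  have hst' : (s : K) * a + t * b = 1 := by exact_mod_cast congrArg (Int.cast : ℤ → K) hst
  have : x = s * (a * x) + t * (b * x) := by linear_combination (-x) * hst'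
  rw [this]
  exact L.add_mem (int_mul_mem L ha s) (int_mul_mem L hb t)

/-- If `δ` multiplies `L₁` into itself and `p δ` multiplies `L₂` into itself, but `δ` does not, then
`p δ` is a nonzero endomorphism of `L₂ / p L₂` of square zero. Its kernel is the line which is
its image, and the products of elements of the image with elements of `L₁` are divisible by `p` in
`L₁ L₂`. So `x + y τ₁` is divisible by `p` as soon as `x` and `y` lie in the kernel. -/
theorem mem_multiplierRing_of_prime_mul (h₁ : L₁ = Submodule.span ℤ {1, τ₁})
    (h₂ : L₂ = Submodule.span ℤ {1, τ₂}) {p : ℕ} (hp : p.Prime) {δ : K}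
    (hδ₁ : δ ∈ multiplierRing L₁) (hδ₂ : p * δ ∈ multiplierRing L₂) {x y : K} (hx : x ∈ L₂)
    (hy : y ∈ L₂) (hδx : δ * x ∈ L₂) (hδy : δ * y ∈ L₂)
    (hxy : ∀ u ∈ L₁ * L₂, x + y * τ₁ ≠ p * u) : δ ∈ multiplierRing L₂ := by
  by_contra hcon
  rw [mem_multiplierRing] at hcon
  push Not at hcon
  obtain ⟨x₁, hx₁, hδx₁⟩ := hcon
  have hpZ := Nat.prime_iff_prime_int.1 hp
  -- `w` spans the image of `p δ` on `L₂ / p L₂`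
  obtain ⟨w, hwdef⟩ : ∃ w, w = p * δ * x₁ := ⟨_, rfl⟩
  have hw : w ∈ L₂ := hwdef ▸ hδ₂ x₁ hx₁
  have hδw : δ * w ∈ L₂ := by
    obtain ⟨a, b, c, d, hab, hcd⟩ := exists_matrix_of_mem_multiplierRing h₁ hδ₁
    have : δ * w = ((b + c : ℤ) : K) * w + ((a * d - b * c : ℤ) * (p : ℤ) : ℤ) * x₁ := by
      rw [hwdef]
      push_cast
      linear_combination (p * x₁ * (δ - c)) * hab + (p * x₁ * a) * hcd
    rw [this]
    exact L₂.add_mem (int_mul_mem L₂ hw _) (int_mul_mem L₂ hx₁ _)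
  obtain ⟨w₁, w₂, hw12⟩ := (mem_iff_of_eq_span h₂).1 hw
  have key : ∀ x ∈ L₂, δ * x ∈ L₂ → ∃ s : ℤ, ∃ l ∈ L₂, x = s * w + p * l := by
    intro x hx hδx
    obtain ⟨x₁', x₂', hx12⟩ := (mem_iff_of_eq_span h₂).1 hx
    have hD : (p : ℤ) ∣ w₁ * x₂' - w₂ * x₁' := by
      by_contra hD
      refine hδx₁ (mem_of_coprime ((hpZ.coprime_iff_not_dvd).2 hD) ?_ ?_)
      · have := hδ₂ x₁ hx₁
        rw [mul_assoc] at this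
        exact_mod_cast this
      · obtain ⟨s, t, hst⟩ := (mem_iff_of_eq_span h₂).1 hx₁
        have : ((w₁ * x₂' - w₂ * x₁' : ℤ) : K) * (δ * x₁) =
            ((s * x₂' - t * x₁' : ℤ) : K) * (δ * w) + ((t * w₁ - s * w₂ : ℤ) : K) * (δ * x) := by
          rw [hst, hw12, hx12]
          push_cast
          ring
        rw [this]
        exact L₂.add_mem (int_mul_mem L₂ hδw _) (int_mul_mem L₂ hδx _)
    obtain ⟨D, hD⟩ := hD
    have hD' : (w₁ : K) * x₂' - w₂ * x₁' = p * D := by exact_mod_cast congrArg (Int.cast : ℤ → K) hD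
    by_cases hw1 : (p : ℤ) ∣ w₁
    · by_cases hw2 : (p : ℤ) ∣ w₂
      · obtain ⟨q₁, rfl⟩ := hw1
        obtain ⟨q₂, rfl⟩ := hw2
        refine (hδx₁ ((mem_iff_of_eq_span h₂).2 ⟨q₁, q₂, ?_⟩)).elim
        have hp0 : (p : K) ≠ 0 := Nat.cast_ne_zero.2 hp.ne_zero
        refine mul_left_cancel₀ hp0 ?_
        rw [← mul_assoc, ← hwdef, hw12]
        push_cast
        ring
      · obtain ⟨a, b, hab⟩ := (hpZ.coprime_iff_not_dvd).2 hw2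
        have hab' : (a : K) * p + b * w₂ = 1 := by exact_mod_cast congrArg (Int.cast : ℤ → K) hab
        refine ⟨b * x₂', a * x + ((-(b * D) : ℤ) : K) * τ₂,
          L₂.add_mem (int_mul_mem L₂ hx a) (int_mul_mem L₂ (gen_mem_of_eq_span h₂) _), ?_⟩
        push_cast
        linear_combination (-x) * hab' + (b * w₂) * hx12 - (b * x₂' : K) * hw12 - (b * τ₂) * hD'
    · obtain ⟨a, b, hab⟩ := (hpZ.coprime_iff_not_dvd).2 hw1
      have hab' : (a : K) * p + b * w₁ = 1 := by exact_mod_cast congrArg (Int.cast : ℤ → K) hab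
      refine ⟨b * x₁', a * x + ((b * D : ℤ) : K) * 1,
        L₂.add_mem (int_mul_mem L₂ hx a) (int_mul_mem L₂ (one_mem_of_eq_span h₂) _), ?_⟩
      push_cast
      linear_combination (-x) * hab' + (b * w₁) * hx12 - (b * x₁' : K) * hw12 + (b : K) * hD'
  obtain ⟨s, l, hl, hsl⟩ := key x hx hδx
  obtain ⟨t, l', hl', htl⟩ := key y hy hδy
  refine hxy (δ * (t * τ₁ + s) * x₁ + (l + l' * τ₁)) ?_ ?_
  · exact Submodule.add_mem _
      (Submodule.mul_mem_mul (hδ₁ _ ((mem_iff_of_eq_span h₁).2 ⟨t, s, rfl⟩)) hx₁)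
      ((mem_mul_iff_of_eq_span h₁).2 ⟨l, hl, l', hl', rfl⟩)
  · rw [hsl, htl, hwdef]
    ring

/-- The lattice in `K²` generated by the columns of the period matrix `(τ₂ 1 z 0; 0 0 τ₁ 1)`. -/
noncomputable def fieldPeriodLattice (τ₁ τ₂ z : K) : Submodule ℤ (K × K) :=
  Submodule.span ℤ {(τ₂, 0), (1, 0), (z, τ₁), (0, 1)}

theorem mem_fieldPeriodLattice (h₂ : L₂ = Submodule.span ℤ {1, τ₂}) {x : K × K} :
    x ∈ fieldPeriodLattice τ₁ τ₂ z ↔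
      ∃ l ∈ L₂, ∃ c d : ℤ, x = (l + c * z, c * τ₁ + d) := by
  rw [fieldPeriodLattice]
  simp only [Submodule.mem_span_insert, Submodule.mem_span_singleton]
  constructor
  · rintro ⟨a, _, ⟨b, _, ⟨c, _, ⟨d, rfl⟩, rfl⟩, rfl⟩, rfl⟩
    exact ⟨a * τ₂ + b, (mem_iff_of_eq_span h₂).2 ⟨a, b, rfl⟩, c, d, by simp [add_assoc]⟩
  · rintro ⟨l, hl, c, d, rfl⟩
    obtain ⟨a, b, rfl⟩ := (mem_iff_of_eq_span h₂).1 hl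
    exact ⟨a, _, ⟨b, _, ⟨c, _, ⟨d, rfl⟩, rfl⟩, rfl⟩, by simp [add_assoc]⟩

theorem mk_zero_mem_fieldPeriodLattice (h₂ : L₂ = Submodule.span ℤ {1, τ₂}) {l : K}
    (hl : l ∈ L₂) : ((l, 0) : K × K) ∈ fieldPeriodLattice τ₁ τ₂ z :=
  (mem_fieldPeriodLattice h₂).2 ⟨l, hl, 0, 0, by simp⟩

theorem zero_one_mem_fieldPeriodLattice :
    ((0, 1) : K × K) ∈ fieldPeriodLattice τ₁ τ₂ z :=
  Submodule.subset_span (by simp)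

theorem gen_mem_fieldPeriodLattice :
    ((z, τ₁) : K × K) ∈ fieldPeriodLattice τ₁ τ₂ z :=
  Submodule.subset_span (by simp)

theorem mem_of_mk_zero_mem (h₂ : L₂ = Submodule.span ℤ {1, τ₂}) (hτ₁ : IndepOne τ₁) {l : K}
    (h : ((l, 0) : K × K) ∈ fieldPeriodLattice τ₁ τ₂ z) : l ∈ L₂ := by
  obtain ⟨l', hl', c, d, hcd⟩ := (mem_fieldPeriodLattice h₂).1 h
  rw [Prod.mk.injEq] at hcd
  obtain ⟨rfl, rfl⟩ := hτ₁ c d hcd.2.symm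
  simpa [hcd.1] using hl'

/-- If `η` multiplies `L₁` and `L₂` into themselves and `n z ∈ L₁ L₂`, then `n η` multiplies the
period lattice into itself. -/
theorem smul_mem_fieldPeriodLattice (h₁ : L₁ = Submodule.span ℤ {1, τ₁})
    (h₂ : L₂ = Submodule.span ℤ {1, τ₂}) {n : ℕ} (hz : n * z ∈ L₁ * L₂) {η : K}
    (hη₁ : η ∈ multiplierRing L₁) (hη₂ : η ∈ multiplierRing L₂) {x : K × K}
    (hx : x ∈ fieldPeriodLattice τ₁ τ₂ z) : (n * η) • x ∈ fieldPeriodLattice τ₁ τ₂ z := by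
  obtain ⟨l, hl, s, t, rfl⟩ := (mem_fieldPeriodLattice h₂).1 hx
  obtain ⟨x, hx, y, hy, hxy⟩ := (mem_mul_iff_of_eq_span h₁).1 hz
  obtain ⟨a, b, c, d, hab, hcd⟩ := exists_matrix_of_mem_multiplierRing h₁ hη₁
  have m1 : n * η * l ∈ L₂ := by
    rw [mul_assoc]
    exact_mod_cast int_mul_mem L₂ (hη₂ l hl) n
  have m2 : (η * x - c * x) + d * y ∈ L₂ := L₂.add_mem
    (L₂.sub_mem (hη₂ x hx) (int_mul_mem L₂ hx c)) (int_mul_mem L₂ hy d)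
  have m3 : a * x + (η * y - b * y) ∈ L₂ := L₂.add_mem (int_mul_mem L₂ hx a)
    (L₂.sub_mem (hη₂ y hy) (int_mul_mem L₂ hy b))
  refine (mem_fieldPeriodLattice h₂).2 ⟨_, L₂.add_mem m1 (L₂.sub_mem (int_mul_mem L₂ m2 s)
    (int_mul_mem L₂ m3 t)), n * (s * c + t * a), n * (s * d + t * b), Prod.ext ?_ ?_⟩
  · simp only [Prod.smul_mk, smul_eq_mul]
    push_cast
    linear_combination (s * (η - c) - t * a : K) * hxy + (s * y : K) * hcd + (t * y : K) * hab
  · simp only [Prod.smul_mk, smul_eq_mul]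
    push_cast
    linear_combination (n * s : K) * hcd + (n * t : K) * hab

/-- A multiplier of the period lattice is the sum of an integer and `n` times a common multiplier of
`L₁` and `L₂`, where `n` is the order of `z` modulo `L₁ L₂`. -/
theorem exists_eq_of_smul_mem_fieldPeriodLattice (h₁ : L₁ = Submodule.span ℤ {1, τ₁})
    (h₂ : L₂ = Submodule.span ℤ {1, τ₂}) (hτ₁ : IndepOne τ₁) {n : ℕ} (hn : n ≠ 0)
    (hz : ∀ k : ℤ, k * z ∈ L₁ * L₂ ↔ (n : ℤ) ∣ k) {α : K}
    (hα : ∀ x ∈ fieldPeriodLattice τ₁ τ₂ z, α • x ∈ fieldPeriodLattice τ₁ τ₂ z) :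
    ∃ a : ℤ, ∃ β ∈ multiplierRing L₁, β ∈ multiplierRing L₂ ∧ α = a + n * β := by
  have hn0 : (n : K) ≠ 0 := Nat.cast_ne_zero.2 hn
  have hα₂ : α ∈ multiplierRing L₂ := fun l hl => by
    refine mem_of_mk_zero_mem (z := z) h₂ hτ₁ ?_
    simpa using hα _ (mk_zero_mem_fieldPeriodLattice h₂ hl)
  obtain ⟨l, hl, a, b, hab⟩ := (mem_fieldPeriodLattice h₂).1 (hα _ zero_one_mem_fieldPeriodLattice)
  obtain ⟨l', hl', c, d, hcd⟩ := (mem_fieldPeriodLattice h₂).1 (hα _ gen_mem_fieldPeriodLattice)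
  simp only [Prod.smul_mk, smul_eq_mul, mul_zero, mul_one, Prod.mk.injEq] at hab hcd
  obtain ⟨hal, hab⟩ := hab
  obtain ⟨hcl, hcd⟩ := hcd
  -- the matrix of `α` on `τ₁, 1` is scalar modulo `n`
  have hza : (a : K) * z ∈ L₁ * L₂ := (mem_mul_iff_of_eq_span h₁).2
    ⟨-l, L₂.neg_mem hl, 0, L₂.zero_mem, by linear_combination -hal⟩
  have hzc : ((c - b : ℤ) : K) * z ∈ L₁ * L₂ := (mem_mul_iff_of_eq_span h₁).2
    ⟨-l', L₂.neg_mem hl', -l, L₂.neg_mem hl, by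
      push_cast
      linear_combination -hcl + z * hab - τ₁ * hal⟩
  have hzd : (d : K) * z ∈ L₁ * L₂ := (mem_mul_iff_of_eq_span h₁).2
    ⟨0, L₂.zero_mem, l', hl', by linear_combination -z * hcd + τ₁ * hcl⟩
  obtain ⟨a', rfl⟩ := (hz a).1 hza
  obtain ⟨e, he⟩ := (hz _).1 hzc
  obtain ⟨d', rfl⟩ := (hz d).1 hzd
  have he' : (c : K) - b = n * e := by exact_mod_cast congrArg (Int.cast : ℤ → K) he
  push_cast at hab hcd hal
  obtain ⟨β, hβ⟩ : ∃ β, α = b + n * β := ⟨(α - b) / n, by field_simp; ring⟩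
  have hβ₁ : β ∈ multiplierRing L₁ := by
    refine mem_multiplierRing_of_matrix h₁ (a := a') (b := 0) (c := e) (d := d') ?_ ?_
    · refine mul_left_cancel₀ hn0 ?_
      push_cast
      linear_combination hab - hβ
    · refine mul_left_cancel₀ hn0 ?_
      linear_combination hcd - τ₁ * hβ + τ₁ * he'
  obtain ⟨x, hx, y, hy, hxy⟩ := (mem_mul_iff_of_eq_span h₁).1 ((hz n).2 dvd_rfl)
  push_cast at hxy
  have hβy : β * y ∈ L₂ := by
    have : β * y = -l - (a' : ℤ) * x := by
      refine mul_left_cancel₀ hn0 ?_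
      linear_combination (-n : K) * hal - (n * a' : K) * hxy + y * hab - y * hβ
    rw [this]
    exact L₂.sub_mem (L₂.neg_mem hl) (int_mul_mem L₂ hx _)
  have hβx : β * x ∈ L₂ := by
    have : β * x = l' - (d' : ℤ) * y + (e : ℤ) * x := by
      refine mul_left_cancel₀ hn0 ?_
      linear_combination -x * hβ + x * he' + (n : K) * hcl - (α - c) * hxy - y * hcd
    rw [this]
    exact L₂.add_mem (L₂.sub_mem hl' (int_mul_mem L₂ hy _)) (int_mul_mem L₂ hx _)
  refine ⟨b, β, hβ₁, ?_, hβ⟩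
  -- `n β` is a multiplier of `L₂`; remove the prime factors of `n` one by one
  have descent : ∀ k : ℕ, k ∣ n → (k : K) * β ∈ multiplierRing L₂ → β ∈ multiplierRing L₂ := by
    intro k
    induction k using induction_on_primes with
    | zero => exact fun h => (hn (zero_dvd_iff.1 h)).elim
    | one => exact fun _ h => by simpa using h
    | prime_mul p k hp ih =>
      intro hk hβk
      refine ih ((Dvd.intro_left p rfl).trans hk) ?_
      have hδ₁ : (k : K) * β ∈ multiplierRing L₁ := Subring.mul_mem _ (natCast_mem _ k) hβ₁
      refine mem_multiplierRing_of_prime_mul h₁ h₂ hp hδ₁ (by simpa [mul_assoc] using hβk) hx hy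
        (by rw [mul_assoc]; exact_mod_cast int_mul_mem L₂ hβx k)
        (by rw [mul_assoc]; exact_mod_cast int_mul_mem L₂ hβy k) fun u hu hxyu => ?_
      obtain ⟨q, rfl⟩ := (Dvd.intro k rfl).trans hk
      have hp0 : (p : K) ≠ 0 := Nat.cast_ne_zero.2 hp.ne_zero
      have hqz : ((q : ℤ) : K) * z ∈ L₁ * L₂ := by
        have : ((q : ℤ) : K) * z = u := by
          refine mul_left_cancel₀ hp0 ?_
          push_cast at hxy ⊢
          linear_combination hxy + hxyu
        exact this ▸ hu
      have hq : p * q ∣ q := Int.natCast_dvd_natCast.1 ((hz q).1 hqz)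
      have hq0 : q ≠ 0 := right_ne_zero_of_mul hn
      have := Nat.le_of_dvd (Nat.pos_of_ne_zero hq0) hq
      nlinarith [hp.two_le, Nat.pos_of_ne_zero hq0]
  refine descent n dvd_rfl ?_
  have : (n : K) * β = α - b := by linear_combination -hβ
  rw [this]
  exact Subring.sub_mem _ hα₂ (intCast_mem _ b)

end PeriodLattices

/-! ### The orders of an imaginary quadratic field -/

section Orders

open NumberField

theorem quadraticOrder_mono {K : IntermediateField ℚ ℂ} {f g : ℕ+} (h : f ∣ g) :
    quadraticOrder K g ≤ quadraticOrder K f := by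
  obtain ⟨c, rfl⟩ := h
  rintro _ ⟨a, y, rfl⟩
  exact ⟨a, c * y, by simp [mul_assoc]⟩

variable (K : IntermediateField ℚ ℂ) [hK : ImaginaryQuadratic K]

/-- The ring of integers of an imaginary quadratic field is `ℤ + ℤ ω`: the quotient of `𝓞 K` by `ℤ`
is torsion-free of rank one. -/
theorem exists_ringOfIntegers_eq :
    ∃ ω : 𝓞 K, ∀ y : 𝓞 K, ∃ a b : ℤ, y = a + b * ω := by
  let N : Submodule ℤ (𝓞 K) := Submodule.span ℤ {1}
  have htf : Module.IsTorsionFree ℤ (𝓞 K ⧸ N) := by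
    refine Module.IsTorsionFree.of_smul_eq_zero fun c q hq => ?_
    obtain ⟨y, rfl⟩ := N.mkQ_surjective q
    refine or_iff_not_imp_left.2 fun hc => (Submodule.Quotient.mk_eq_zero N).2 ?_
    obtain ⟨d, hd⟩ := Submodule.mem_span_singleton.1
      ((Submodule.Quotient.mk_eq_zero N (x := c • y)).1 hq)
    have hcK : (c : K) ≠ 0 := Int.cast_ne_zero.2 hc
    have hy : algebraMap (𝓞 K) K y = algebraMap ℚ K (d / c) := by
      have h := congrArg (algebraMap (𝓞 K) K) hd
      simp at h
      simp [h, hcK]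
    have hint : IsIntegral ℤ ((d : ℚ) / c) := by
      have := y.isIntegral_coe
      rw [hy] at this
      exact (isIntegral_algebraMap_iff (algebraMap ℚ K).injective).1 this
    obtain ⟨m, hm⟩ := IsIntegrallyClosed.isIntegral_iff.1 hint
    refine Submodule.mem_span_singleton.2 ⟨m, ?_⟩
    apply RingOfIntegers.coe_injective
    rw [hy, ← hm]
    simp
  have hrank : Module.finrank ℤ (𝓞 K ⧸ N) = 1 := by
    have h1 : Module.finrank ℤ N = 1 := by
      rw [← (LinearEquiv.toSpanNonzeroSingleton ℤ (𝓞 K) 1 one_ne_zero).finrank_eq,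
        Module.finrank_self]
    have h2 := Submodule.finrank_quotient_add_finrank N
    rw [RingOfIntegers.rank, hK.finrank_eq, h1] at h2
    omega
  obtain ⟨q, -, hq⟩ := finrank_eq_one_iff'.1 hrank
  obtain ⟨ω, rfl⟩ := N.mkQ_surjective q
  refine ⟨ω, fun y => ?_⟩
  obtain ⟨b, hb⟩ := hq (N.mkQ y)
  have : N.mkQ (y - b • ω) = 0 := by
    rw [map_sub, map_smul, hb, sub_self]
  obtain ⟨a, ha⟩ := Submodule.mem_span_singleton.1 ((Submodule.Quotient.mk_eq_zero N).1 this)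
  refine ⟨a, b, ?_⟩
  simp only [zsmul_eq_mul, mul_one] at ha
  rw [ha]
  ring

/-- There is `ω` with `𝒪_f = ℤ + ℤ f ω` for all `f`. -/
theorem exists_quadraticOrder_eq :
    ∃ ω : K, (ω : ℂ).im ≠ 0 ∧ ∀ (f : ℕ+) (x : K),
      x ∈ quadraticOrder K f ↔ ∃ a b : ℤ, x = a + b * ((f : ℕ) * ω) := by
  obtain ⟨ω, hω⟩ := exists_ringOfIntegers_eq K
  have hiff : ∀ (f : ℕ+) (x : K),
      x ∈ quadraticOrder K f ↔ ∃ a b : ℤ, x = a + b * ((f : ℕ) * (ω : K)) := by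
    intro f x
    constructor
    · rintro ⟨a, y, rfl⟩
      obtain ⟨s, t, rfl⟩ := hω y
      refine ⟨a + f * s, t, ?_⟩
      simp
      ring
    · rintro ⟨a, b, rfl⟩
      refine ⟨a, b * ω, ?_⟩
      simp
      ring
  refine ⟨ω, fun him => ?_, hiff⟩
  obtain ⟨w, hwK, hw⟩ := hK.exists_im_ne_zero
  have hx : IsAlgebraic ℤ (⟨w, hwK⟩ : K) :=
    (IsFractionRing.isAlgebraic_iff ℤ ℚ K).2 (IsAlgebraic.of_finite ℚ _)
  obtain ⟨d, hd, hy⟩ := hx.exists_integral_multiple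
  obtain ⟨a, b, hab⟩ := hω ⟨d • ⟨w, hwK⟩, hy⟩
  have h := congrArg (fun y : 𝓞 K => (((y : K) : ℂ)).im) hab
  simp [him, hd, hw] at h

variable {K}

theorem inter_quadraticOrder {f₁ f₂ : ℕ+} {x : K} (h1 : x ∈ quadraticOrder K f₁)
    (h2 : x ∈ quadraticOrder K f₂) : x ∈ quadraticOrder K (PNat.lcm f₁ f₂) := by
  obtain ⟨ω, him, hω⟩ := exists_quadraticOrder_eq K
  obtain ⟨a, b, hab⟩ := (hω _ _).1 h1
  obtain ⟨c, d, hcd⟩ := (hω _ _).1 h2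
  obtain ⟨h, -⟩ := (indepOne_of_im_ne_zero him).eq (a := b * f₁) (b := a) (a' := d * f₂) (b' := c)
    (by push_cast; linear_combination hcd - hab)
  have hdvd : ((PNat.lcm f₁ f₂ : ℕ) : ℤ) ∣ b * f₁ := by
    rw [PNat.lcm_coe]
    exact Int.coe_lcm_dvd (Dvd.intro_left b rfl) (h ▸ Dvd.intro_left d rfl)
  obtain ⟨e, he⟩ := hdvd
  refine (hω _ _).2 ⟨a, e, ?_⟩
  have he' : (b : K) * (f₁ : ℕ) = (PNat.lcm f₁ f₂ : ℕ) * e := by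
    exact_mod_cast congrArg (Int.cast : ℤ → K) he
  linear_combination hab + ω * he'

/-- Every element of `K` has an integral multiple in `𝒪_f`. -/
theorem exists_int_mul_mem_quadraticOrder (f : ℕ+) (x : K) :
    ∃ d : ℤ, d ≠ 0 ∧ d * x ∈ quadraticOrder K f := by
  have hx : IsAlgebraic ℤ x :=
    (IsFractionRing.isAlgebraic_iff ℤ ℚ K).2 (IsAlgebraic.of_finite ℚ _)
  obtain ⟨d, hd, hy⟩ := hx.exists_integral_multiple
  refine ⟨f * d, mul_ne_zero (by simp) hd, 0, ⟨d • x, hy⟩, ?_⟩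
  simp [mul_assoc]

end Orders

/-! ### The decomposition of the period lattice in `K²` -/

section Decomposition

open scoped Pointwise

variable {K : IntermediateField ℚ ℂ} {L₁ L₂ : Submodule ℤ K} {τ₁ τ₂ z : K}

/-- Multiplication by `α` on a subgroup of `K × K` which it preserves. -/
noncomputable def mulEnd (Λ : Submodule ℤ (K × K)) (α : K) (h : ∀ x ∈ Λ, α • x ∈ Λ) :
    Module.End ℤ Λ :=
  (DistribSMul.toLinearMap ℤ (K × K) α).restrict h

@[simp] theorem coe_mulEnd (Λ : Submodule ℤ (K × K)) (α : K) (h : ∀ x ∈ Λ, α • x ∈ Λ) (x : Λ) :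
    (mulEnd Λ α h x : K × K) = α • (x : K × K) := rfl

/-- Multiplication by `α` on a subgroup of `K` which it preserves. -/
noncomputable def mulEndOfMem (L : Submodule ℤ K) (α : K) (h : α ∈ multiplierRing L) :
    Module.End ℤ L :=
  (DistribSMul.toLinearMap ℤ K α).restrict h

@[simp] theorem coe_mulEndOfMem (L : Submodule ℤ K) (α : K) (h : α ∈ multiplierRing L) (x : L) :
    (mulEndOfMem L α h x : K) = α * (x : K) := rfl

theorem mem_smul_top_coe {V : Type*} [AddCommGroup V] {Λ : Submodule ℤ V} {p : ℤ} {x : Λ} :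
    x ∈ p • (⊤ : Submodule ℤ Λ) ↔ ∃ y ∈ Λ, p • y = (x : V) := by
  rw [mem_smul_top_iff]
  constructor
  · rintro ⟨y, rfl⟩
    exact ⟨y, y.2, rfl⟩
  · rintro ⟨y, hy, h⟩
    exact ⟨⟨y, hy⟩, Subtype.ext h⟩

/-- For a lattice of rank two, `y` and `Ω y` are independent modulo almost all primes. -/
theorem exists_forall_indepMod_mulEndOfMem {L : Submodule ℤ K} {τ : K}
    (h : L = Submodule.span ℤ {1, τ}) (hτ : IndepOne τ) {Ω : K} (hΩ : IndepOne Ω)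
    (hΩL : Ω ∈ multiplierRing L) (y : L) (hy : y ≠ 0) :
    ∃ l : ℕ, l ≠ 0 ∧ ∀ p : ℕ, p.Prime → ¬ p ∣ l → IndepMod (mulEndOfMem L Ω hΩL) p y := by
  obtain ⟨y, hyL⟩ := y
  obtain ⟨y₁, y₂, hy12⟩ := (mem_iff_of_eq_span h).1 hyL
  obtain ⟨u₁, u₂, hu12⟩ := (mem_iff_of_eq_span h).1 (hΩL y hyL)
  have hy0 : y ≠ 0 := fun h0 => hy (Subtype.ext h0)
  refine ⟨(y₁ * u₂ - y₂ * u₁).natAbs, fun hD => ?_, fun p hp hpD s t hst => ?_⟩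
  · have hD' : (y₁ : K) * u₂ - y₂ * u₁ = 0 := by
      exact_mod_cast congrArg (Int.cast : ℤ → K) (Int.natAbs_eq_zero.1 hD)
    obtain ⟨hy1, -⟩ := hΩ y₁ (-u₁) (mul_right_cancel₀ hy0 (by
      push_cast
      linear_combination (y₁ : K) * hu12 - (u₁ : K) * hy12 + hD'))
    obtain ⟨hy2, -⟩ := hΩ y₂ (-u₂) (mul_right_cancel₀ hy0 (by
      push_cast
      linear_combination (y₂ : K) * hu12 - (u₂ : K) * hy12 - τ * hD'))
    exact hy0 (by simp [hy12, hy1, hy2])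
  · have hpZ := Nat.prime_iff_prime_int.1 hp
    rw [← Int.natCast_dvd] at hpD
    obtain ⟨q, hq, hqe⟩ := mem_smul_top_coe.1 hst
    obtain ⟨q₁, q₂, rfl⟩ := (mem_iff_of_eq_span h).1 hq
    simp only [Submodule.coe_add, Submodule.coe_smul, coe_mulEndOfMem, zsmul_eq_mul] at hqe
    obtain ⟨e1, e2⟩ := hτ.eq (a := s * y₁ + t * u₁) (b := s * y₂ + t * u₂) (a' := p * q₁)
      (b' := p * q₂) (by
        push_cast at hqe ⊢
        linear_combination -hqe - (s : K) * hy12 - (t : K) * hu12)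
    constructor
    · refine (hpZ.dvd_or_dvd ?_).resolve_right hpD
      exact ⟨u₂ * q₁ - u₁ * q₂, by linear_combination u₂ * e1 - u₁ * e2⟩
    · refine (hpZ.dvd_or_dvd ?_).resolve_right hpD
      exact ⟨y₁ * q₂ - y₂ * q₁, by linear_combination y₁ * e2 - y₂ * e1⟩

/-- If `Ω` is a multiplier of the period lattice and all its multipliers lie in `ℤ + ℤ Ω`, then the
lattice contains a vector independent of its multiple by `Ω` modulo every prime. -/
theorem exists_forall_indepMod_fieldPeriodLattice (h₁ : L₁ = Submodule.span ℤ {1, τ₁})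
    (h₂ : L₂ = Submodule.span ℤ {1, τ₂}) (hτ₁ : IndepOne τ₁) (hτ₂ : IndepOne τ₂) {Ω : K}
    (hΩ : IndepOne Ω) (hΩ₁ : Ω ∈ multiplierRing L₁) (hΩ₂ : Ω ∈ multiplierRing L₂)
    (hΩΛ : ∀ x ∈ fieldPeriodLattice τ₁ τ₂ z, Ω • x ∈ fieldPeriodLattice τ₁ τ₂ z)
    (hmax : ∀ α : K, (∀ x ∈ fieldPeriodLattice τ₁ τ₂ z, α • x ∈ fieldPeriodLattice τ₁ τ₂ z) →
      ∃ a b : ℤ, α = a + b * Ω) [Module.Free ℤ (fieldPeriodLattice τ₁ τ₂ z)] :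
    ∃ v, ∀ p : ℕ, p.Prime → IndepMod (mulEnd (fieldPeriodLattice τ₁ τ₂ z) Ω hΩΛ) p v := by
  let Λ := fieldPeriodLattice τ₁ τ₂ z
  have hsnd : ∀ x ∈ Λ, x.2 ∈ L₁ := fun x hx => by
    obtain ⟨l, hl, c, d, rfl⟩ := (mem_fieldPeriodLattice h₂).1 hx
    exact (mem_iff_of_eq_span h₁).2 ⟨c, d, rfl⟩
  let π : Λ →ₗ[ℤ] L₁ := (LinearMap.snd ℤ K K).restrict hsnd
  obtain ⟨a, b, hab⟩ := (mem_iff_of_eq_span h₂).1 (hΩ₂ 1 (one_mem_of_eq_span h₂))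
  rw [mul_one] at hab
  have ha0 : a ≠ 0 := by
    rintro rfl
    exact one_ne_zero (hΩ 1 (-b) (by push_cast at hab ⊢; linear_combination hab)).1
  refine exists_forall_indepMod (π := π) (φ₁ := mulEndOfMem L₁ Ω hΩ₁) ?_ (fun x => rfl) ?_
    (e := ⟨(1, 0), mk_zero_mem_fieldPeriodLattice h₂ (one_mem_of_eq_span h₂)⟩) rfl
    (Int.natAbs_ne_zero.2 ha0) ?_ (exists_forall_indepMod_mulEndOfMem h₁ hτ₁ hΩ hΩ₁)
    ⟨⟨1, one_mem_of_eq_span h₁⟩, fun h => one_ne_zero (congrArg Subtype.val h)⟩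
  · rintro ⟨x, hx⟩
    obtain ⟨c, d, rfl⟩ := (mem_iff_of_eq_span h₁).1 hx
    exact ⟨⟨(0 + c * z, c * τ₁ + d),
      (mem_fieldPeriodLattice h₂).2 ⟨0, L₂.zero_mem, c, d, rfl⟩⟩, rfl⟩
  · -- if `Ω` were congruent to `c` modulo `p`, then `(Ω - c) / p` would be a multiplier
    intro p hp c
    by_contra! hcon
    have hp0 : (p : K) ≠ 0 := Nat.cast_ne_zero.2 hp.ne_zero
    obtain ⟨s, t, hst⟩ := hmax ((Ω - c) / p) fun x hx => by
      obtain ⟨y, hy, hyx⟩ := mem_smul_top_coe.1 (hcon ⟨x, hx⟩)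
      have : ((Ω - c) / p) • x = y := by
        have hyx' : (p : K) • y = (Ω - c) • x := by
          rw [sub_smul]
          simpa [← Int.cast_smul_eq_zsmul K] using hyx
        rw [div_eq_inv_mul, mul_smul, ← hyx', inv_smul_smul₀ hp0]
      exact this ▸ hy
    rw [div_eq_iff hp0] at hst
    obtain ⟨h1, -⟩ := hΩ (1 - t * p) (-c - s * p) (by push_cast; linear_combination hst)
    exact (Nat.prime_iff_prime_int.1 hp).not_dvd_one (Dvd.intro_left t (by linarith))
  · intro p hp hpa s t hst
    have hpZ := Nat.prime_iff_prime_int.1 hp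
    rw [← Int.natCast_dvd] at hpa
    obtain ⟨q, hq, hqe⟩ := mem_smul_top_coe.1 hst
    obtain ⟨l, hl, c, d, rfl⟩ := (mem_fieldPeriodLattice h₂).1 hq
    obtain ⟨l₁, l₂, rfl⟩ := (mem_iff_of_eq_span h₂).1 hl
    simp [Prod.ext_iff] at hqe
    obtain ⟨hq1, hq2⟩ := hqe
    have hp0 : (p : K) ≠ 0 := Nat.cast_ne_zero.2 hp.ne_zero
    obtain ⟨rfl, rfl⟩ := hτ₁ c d (mul_left_cancel₀ hp0 (by linear_combination hq2))
    obtain ⟨e1, e2⟩ := hτ₂.eq (a := t * a) (b := s + t * b) (a' := p * l₁) (b' := p * l₂) (by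
      push_cast at hq1 ⊢
      linear_combination -hq1 - (t : K) * hab)
    have ht : (p : ℤ) ∣ t := (hpZ.dvd_or_dvd ⟨_, e1⟩).resolve_right hpa
    exact ⟨(dvd_add_left (ht.mul_right b)).1 ⟨_, e2⟩, ht⟩

/-- Let `Λ ⊂ K²` contain the standard basis and let `Ω` be a multiplier of `Λ`. If some `v ∈ Λ` is
independent of `Ω v` modulo every prime, then a linear form with coefficients `r` maps `Λ` to
`𝒪 = ℤ + ℤ Ω` and takes the value `1` at a vector `w ∈ Λ`, so that `𝒪 w` is a direct summand of `Λ`.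
-/
theorem exists_splitting {Λ : Submodule ℤ (K × K)} {Ω : K} [Module.Free ℤ Λ]
    {T N : ℤ} (hΩ : Ω * Ω = T * Ω + N)
    (hden : ∀ k : K, ∃ d : ℤ, d ≠ 0 ∧ ∃ s t : ℤ, d * k = s + t * Ω)
    (hΩΛ : ∀ x ∈ Λ, Ω • x ∈ Λ) (h10 : (1, 0) ∈ Λ) (h01 : (0, 1) ∈ Λ)
    {v : Λ} (hv : ∀ p : ℕ, p.Prime → IndepMod (mulEnd Λ Ω hΩΛ) p v) :
    ∃ r w : K × K, w ∈ Λ ∧ r.1 * w.1 + r.2 * w.2 = 1 ∧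
      ∀ x ∈ Λ, ∃ s t : ℤ, r.1 * x.1 + r.2 * x.2 = s + t * Ω := by
  obtain ⟨ℓ, hℓv, hℓΩ⟩ := exists_functional_of_forall_indepMod hv
  let φ := mulEnd Λ Ω hΩΛ
  -- the `ℤ[Ω]`-linear map with `Ω`-coordinate `ℓ`
  let ρ : Λ →ₗ[ℤ] K := (Algebra.linearMap ℤ K).comp (ℓ.comp φ - T • ℓ) +
    (Ω • Algebra.linearMap ℤ K).comp ℓ
  have hρ : ∀ x, ρ x = ((ℓ (φ x) - T * ℓ x : ℤ) : K) + ℓ x * Ω := fun x => by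
    simp [ρ, mul_comm]
  have hφφ : ∀ x, φ (φ x) = T • φ x + N • x := fun x => by
    refine Subtype.ext ?_
    simp only [φ, coe_mulEnd, Submodule.coe_add, Submodule.coe_smul, smul_smul, hΩ]
    rw [add_smul, mul_smul, Int.cast_smul_eq_zsmul, Int.cast_smul_eq_zsmul]
  have hρφ : ∀ x, ρ (φ x) = Ω * ρ x := fun x => by
    rw [hρ, hρ, hφφ]
    simp only [map_add, map_smul, smul_eq_mul]
    push_cast
    linear_combination (-(ℓ x) : K) * hΩ
  have hρv : ρ v = 1 := by rw [hρ, hℓv, hℓΩ]; simp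
  refine ⟨(ρ ⟨_, h10⟩, ρ ⟨_, h01⟩), v, v.2, ?_⟩
  -- `ρ` is the restriction of a `K`-linear form
  have hlin : ∀ x : Λ, ρ ⟨_, h10⟩ * (x : K × K).1 + ρ ⟨_, h01⟩ * (x : K × K).2 = ρ x := by
    intro x
    obtain ⟨d₁, hd₁, s₁, t₁, h1⟩ := hden (x : K × K).1
    obtain ⟨d₂, hd₂, s₂, t₂, h2⟩ := hden (x : K × K).2
    have hx : (d₁ * d₂) • x = d₂ • (s₁ • ⟨_, h10⟩ + t₁ • φ ⟨_, h10⟩) +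
        d₁ • (s₂ • ⟨_, h01⟩ + t₂ • φ ⟨_, h01⟩) := by
      refine Subtype.ext (Prod.ext ?_ ?_)
      · simp [φ]
        linear_combination (d₂ : K) * h1
      · simp [φ]
        linear_combination (d₁ : K) * h2
    have h3 := congrArg ρ hx
    simp only [map_add, map_smul, hρφ, zsmul_eq_mul] at h3
    have hd : (d₁ : K) * d₂ ≠ 0 := mul_ne_zero (Int.cast_ne_zero.2 hd₁) (Int.cast_ne_zero.2 hd₂)
    refine mul_left_cancel₀ hd ?_
    push_cast at h3
    linear_combination -h3 + d₂ * ρ ⟨_, h10⟩ * h1 + d₁ * ρ ⟨_, h01⟩ * h2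
  refine ⟨by rw [hlin, hρv], fun x hx => ⟨_, _, (hlin ⟨x, hx⟩).trans (hρ _)⟩⟩

/-- The period lattice of a point `z` of order `n` is, up to a linear change of coordinates in `K²`,
the direct sum of `𝒪_{nf}`, with `f` the least common multiple of the conductors, and the lattice
`L₁ L₂ + ℤ z` of all determinants of pairs of its elements. -/
theorem exists_fieldPeriodLattice_iff [ImaginaryQuadratic K]
    (h₁ : L₁ = Submodule.span ℤ {1, τ₁})
    (h₂ : L₂ = Submodule.span ℤ {1, τ₂}) (hτ₁ : IndepOne τ₁) (hτ₂ : IndepOne τ₂)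
    {f₁ f₂ : ℕ+} (hf₁ : HasConductor L₁ f₁) (hf₂ : HasConductor L₂ f₂)
    {n : ℕ+} (hz : ∀ k : ℤ, k * z ∈ L₁ * L₂ ↔ ((n : ℕ) : ℤ) ∣ k) :
    ∃ r v : K × K, r.1 * v.1 + r.2 * v.2 = 1 ∧ ∀ x : K × K,
      x ∈ fieldPeriodLattice τ₁ τ₂ z ↔
        r.1 * x.1 + r.2 * x.2 ∈ quadraticOrder K (n * PNat.lcm f₁ f₂) ∧
        ∃ k : ℤ, v.1 * x.2 - v.2 * x.1 - k * z ∈ L₁ * L₂ := by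
  obtain ⟨ω, him, hω⟩ := exists_quadraticOrder_eq K
  have hfin : Module.Finite ℤ (fieldPeriodLattice τ₁ τ₂ z) :=
    Module.Finite.span_of_finite ℤ (Set.toFinite _)
  let Λ := fieldPeriodLattice τ₁ τ₂ z
  let f := PNat.lcm f₁ f₂
  obtain ⟨Ω, hΩdef⟩ : ∃ Ω : K, Ω = ((n * f : ℕ+) : ℕ) * ω := ⟨_, rfl⟩
  have hord : ∀ x : K, x ∈ quadraticOrder K (n * f) ↔ ∃ a b : ℤ, x = a + b * Ω := fun x => by
    rw [hω, hΩdef]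
  have hΩ : IndepOne Ω := indepOne_of_im_ne_zero (by simp [hΩdef, him])
  have hη : (f : ℕ) * ω ∈ quadraticOrder K f := (hω _ _).2 ⟨0, 1, by simp⟩
  have hη₁ : (f : ℕ) * ω ∈ multiplierRing L₁ := by
    rw [hf₁]
    exact quadraticOrder_mono (PNat.dvd_lcm_left f₁ f₂) hη
  have hη₂ : (f : ℕ) * ω ∈ multiplierRing L₂ := by
    rw [hf₂]
    exact quadraticOrder_mono (PNat.dvd_lcm_right f₁ f₂) hη
  have hΩη : Ω = (n : ℕ) * ((f : ℕ) * ω) := by rw [hΩdef]; push_cast; ring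
  have hΩ₁ : Ω ∈ multiplierRing L₁ := hΩη ▸ Subring.mul_mem _ (natCast_mem _ _) hη₁
  have hΩ₂ : Ω ∈ multiplierRing L₂ := hΩη ▸ Subring.mul_mem _ (natCast_mem _ _) hη₂
  have hΩΛ : ∀ x ∈ Λ, Ω • x ∈ Λ := fun x hx => hΩη ▸ smul_mem_fieldPeriodLattice h₁ h₂
    (by exact_mod_cast (hz n).2 dvd_rfl) hη₁ hη₂ hx
  have hmax : ∀ α : K, (∀ x ∈ Λ, α • x ∈ Λ) → ∃ a b : ℤ, α = a + b * Ω := by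
    intro α hα
    obtain ⟨a, β, hβ₁, hβ₂, rfl⟩ :=
      exists_eq_of_smul_mem_fieldPeriodLattice h₁ h₂ hτ₁ n.ne_zero hz hα
    rw [hf₁] at hβ₁
    rw [hf₂] at hβ₂
    obtain ⟨s, t, rfl⟩ := (hω f _).1 (inter_quadraticOrder hβ₁ hβ₂)
    exact ⟨a + n * s, t, by rw [hΩη]; push_cast; ring⟩
  obtain ⟨v, hv⟩ := exists_forall_indepMod_fieldPeriodLattice h₁ h₂ hτ₁ hτ₂ hΩ hΩ₁ hΩ₂ hΩΛ hmax
  obtain ⟨N, T, hTN⟩ := (hord _).1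
    (Subring.mul_mem _ ((hord Ω).2 ⟨0, 1, by simp⟩) ((hord Ω).2 ⟨0, 1, by simp⟩))
  obtain ⟨r, v, hvΛ, hrv, hr⟩ := exists_splitting (T := T) (N := N) (by rw [hTN]; ring)
    (fun k => by
      obtain ⟨d, hd, hdk⟩ := exists_int_mul_mem_quadraticOrder (n * f) k
      exact ⟨d, hd, (hord _).1 hdk⟩)
    hΩΛ (mk_zero_mem_fieldPeriodLattice h₂ (one_mem_of_eq_span h₂))
    zero_one_mem_fieldPeriodLattice hv
  have hOΛ : ∀ α ∈ quadraticOrder K (n * f), ∀ x ∈ Λ, α • x ∈ Λ := by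
    intro α hα x hx
    obtain ⟨s, t, rfl⟩ := (hord α).1 hα
    rw [add_smul, mul_smul, Int.cast_smul_eq_zsmul, Int.cast_smul_eq_zsmul]
    exact Λ.add_mem (Λ.smul_mem s hx) (Λ.smul_mem t (hΩΛ x hx))
  have hrO : ∀ x ∈ Λ, r.1 * x.1 + r.2 * x.2 ∈ quadraticOrder K (n * f) := fun x hx =>
    (hord _).2 (hr x hx)
  -- by the Plücker relation, all determinants on `Λ` are of the form `det (v, y)`
  have plucker : ∀ x ∈ Λ, ∀ y ∈ Λ, ∃ u ∈ Λ, v.1 * u.2 - v.2 * u.1 = x.1 * y.2 - x.2 * y.1 := by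
    intro x hx y hy
    refine ⟨_, Λ.sub_mem (hOΛ _ (hrO x hx) y hy) (hOΛ _ (hrO y hy) x hx), ?_⟩
    simp only [Prod.fst_sub, Prod.snd_sub, Prod.smul_fst, Prod.smul_snd, smul_eq_mul]
    linear_combination (x.1 * y.2 - x.2 * y.1) * hrv
  have hdet : ∀ β : K, (∃ k : ℤ, β - k * z ∈ L₁ * L₂) → ∃ u ∈ Λ, v.1 * u.2 - v.2 * u.1 = β := by
    rintro β ⟨k, hk⟩
    obtain ⟨l, hl, l', hl', h⟩ := (mem_mul_iff_of_eq_span h₁).1 hk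
    obtain ⟨u, hu, hu'⟩ := plucker _ (mk_zero_mem_fieldPeriodLattice h₂ hl) _
      zero_one_mem_fieldPeriodLattice
    obtain ⟨u', hu₁, hu₁'⟩ := plucker _ (mk_zero_mem_fieldPeriodLattice h₂ hl') _
      gen_mem_fieldPeriodLattice
    obtain ⟨u'', hu₂, hu₂'⟩ := plucker _ gen_mem_fieldPeriodLattice _
      zero_one_mem_fieldPeriodLattice
    refine ⟨u + u' + k • u'', Λ.add_mem (Λ.add_mem hu hu₁) (Λ.smul_mem k hu₂), ?_⟩
    simp only [Prod.fst_add, Prod.snd_add, Prod.smul_fst, Prod.smul_snd]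
    simp only [zsmul_eq_mul]
    linear_combination hu' + hu₁' + k * hu₂' - h
  refine ⟨r, v, hrv, fun x => ⟨fun hx => ⟨hrO x hx, ?_⟩, fun ⟨hx, hx'⟩ => ?_⟩⟩
  · obtain ⟨l, hl, c, d, hx⟩ := (mem_fieldPeriodLattice h₂).1 hx
    obtain ⟨l', hl', c', d', hv'⟩ := (mem_fieldPeriodLattice h₂).1 hvΛ
    refine ⟨c' * d - d' * c, (mem_mul_iff_of_eq_span h₁).2 ⟨(d : ℤ) * l' - (d' : ℤ) * l,
      L₂.sub_mem (int_mul_mem L₂ hl' d) (int_mul_mem L₂ hl d'), (c : ℤ) * l' - (c' : ℤ) * l,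
      L₂.sub_mem (int_mul_mem L₂ hl' c) (int_mul_mem L₂ hl c'), ?_⟩⟩
    rw [hx, hv']
    push_cast
    ring
  · obtain ⟨u, hu, hu'⟩ := hdet _ hx'
    have : x = u + (r.1 * x.1 + r.2 * x.2 - (r.1 * u.1 + r.2 * u.2)) • v := by
      refine Prod.ext ?_ ?_
      · simp only [Prod.fst_add, Prod.smul_fst, smul_eq_mul]
        linear_combination (u.1 - x.1) * hrv + r.2 * hu'
      · simp only [Prod.snd_add, Prod.smul_snd, smul_eq_mul]
        linear_combination (u.2 - x.2) * hrv - r.1 * hu'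
    rw [this]
    exact Λ.add_mem hu (hOΛ _ (Subring.sub_mem _ hx (hrO u hu)) v hvΛ)

end Decomposition

/-! ### The decomposition of the complex torus -/

section Main

/-- The linear automorphism of `ℂ²` with matrix `(r₁ r₂; -v₂ v₁)` of determinant one. -/
noncomputable def unimodularEquiv (r v : ℂ × ℂ) (h : r.1 * v.1 + r.2 * v.2 = 1) :
    (ℂ × ℂ) ≃ₗ[ℂ] (ℂ × ℂ) where
  toFun x := (r.1 * x.1 + r.2 * x.2, v.1 * x.2 - v.2 * x.1)
  invFun y := (v.1 * y.1 - r.2 * y.2, v.2 * y.1 + r.1 * y.2)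
  map_add' x y := by ext <;> simp <;> ring
  map_smul' a x := by ext <;> simp <;> ring
  left_inv x := by
    ext
    · simp only
      linear_combination x.1 * h
    · simp only
      linear_combination x.2 * h
  right_inv y := by
    ext
    · simp only
      linear_combination y.1 * h
    · simp only
      linear_combination y.2 * h

theorem unimodularEquiv_apply (r v : ℂ × ℂ) (h : r.1 * v.1 + r.2 * v.2 = 1) (x : ℂ × ℂ) :
    unimodularEquiv r v h x = (r.1 * x.1 + r.2 * x.2, v.1 * x.2 - v.2 * x.1) := rfl

variable {K : IntermediateField ℚ ℂ} {τ₁ τ₂ : K}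

theorem mem_periodLattice_coe {z : K} {x : ℂ × ℂ} :
    x ∈ periodLattice (τ₁ : ℂ) τ₂ z ↔
      ∃ y ∈ fieldPeriodLattice τ₁ τ₂ z, x = ((y.1 : ℂ), (y.2 : ℂ)) := by
  rw [mem_periodLattice]
  constructor
  · rintro ⟨a, b, c, d, rfl⟩
    exact ⟨(a * τ₂ + b + c * z, c * τ₁ + d), (mem_fieldPeriodLattice rfl).2
      ⟨_, (mem_iff_of_eq_span rfl).2 ⟨a, b, rfl⟩, c, d, rfl⟩, by simp⟩
  · rintro ⟨y, hy, rfl⟩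
    obtain ⟨l, hl, c, d, rfl⟩ := (mem_fieldPeriodLattice rfl).1 hy
    obtain ⟨a, b, rfl⟩ := (mem_iff_of_eq_span rfl).1 hl
    exact ⟨a, b, c, d, by simp⟩

/-- Membership in a period lattice, written in unimodular coordinates over `K`, may be tested over
`ℂ`. -/
theorem mem_periodLattice_iff_unimodularEquiv {O M : Submodule ℤ K} {w : K} {r v : K × K}
    (hrv : r.1 * v.1 + r.2 * v.2 = 1)
    (hiff : ∀ x : K × K, x ∈ fieldPeriodLattice τ₁ τ₂ w ↔
      r.1 * x.1 + r.2 * x.2 ∈ O ∧ ∃ k : ℤ, v.1 * x.2 - v.2 * x.1 - k * w ∈ M)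
    (hrvC : (r.1 : ℂ) * v.1 + r.2 * v.2 = 1) (x : ℂ × ℂ) :
    x ∈ periodLattice (τ₁ : ℂ) τ₂ w ↔
      (unimodularEquiv (r.1, r.2) (v.1, v.2) hrvC x).1 ∈ toComplex O ∧
      ∃ k : ℤ, (unimodularEquiv (r.1, r.2) (v.1, v.2) hrvC x).2 - k * w ∈ toComplex M := by
  rw [mem_periodLattice_coe]
  constructor
  · rintro ⟨y, hy, rfl⟩
    obtain ⟨hO, k, hk⟩ := (hiff y).1 hy
    exact ⟨⟨_, hO, by simp [unimodularEquiv_apply]⟩, k, ⟨_, hk, by simp [unimodularEquiv_apply]⟩⟩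
  · rintro ⟨⟨α, hα, hαx⟩, k, β, hβ, hβx⟩
    have hα' : (α : ℂ) = r.1 * x.1 + r.2 * x.2 := hαx
    have hβ' : (β : ℂ) = v.1 * x.2 - v.2 * x.1 - k * w := hβx
    refine ⟨(v.1 * α - r.2 * (β + k * w), v.2 * α + r.1 * (β + k * w)), (hiff _).2 ⟨?_, k, ?_⟩,
      Prod.ext ?_ ?_⟩
    · convert (show α ∈ O from hα) using 1
      linear_combination α * hrv
    · convert (show β ∈ M from hβ) using 1
      linear_combination (β + k * w) * hrv
    · push_cast
      rw [hα', hβ']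
      linear_combination (-x.1) * hrvC
    · push_cast
      rw [hα', hβ']
      linear_combination (-x.2) * hrvC

theorem mem_quot_lattice {A : ComplexTorus} {z x : A.V} (hP : IsOfFinAddOrder (A.proj z)) :
    x ∈ (A.quot (A.proj z) hP).Λ ↔ ∃ k : ℤ, x - k • z ∈ A.Λ := by
  change A.proj x ∈ Submodule.span ℤ {A.proj z} ↔ _
  rw [Submodule.mem_span_singleton]
  refine exists_congr fun k => ?_
  rw [← map_smul, eq_comm]
  exact Submodule.Quotient.eq A.Λ

theorem mainTheorem4 (K : IntermediateField ℚ ℂ) [ImaginaryQuadratic K]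
    (L₁ L₂ : Submodule ℤ K) [L₁.IsLattice ℚ] [L₂.IsLattice ℚ] (τ₁ τ₂ : K)
    (h₁ : L₁ = Submodule.span ℤ {1, τ₁}) (h₂ : L₂ = Submodule.span ℤ {1, τ₂})
    (f₁ f₂ : ℕ+) (hf₁ : HasConductor L₁ f₁) (hf₂ : HasConductor L₂ f₂)
    (n : ℕ+) (P : (ellipticCurve (L₁ * L₂)).Pts) (hP : IsOfFinAddOrder P)
    (hn : addOrderOf P = n)
    (X : ComplexTorus.Extension (ellipticCurve L₁) (ellipticCurve L₂))
    (hX : X.cls = toExt h₁ h₂ P) :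
    Nonempty (ComplexTorus.Iso X.S
      ((ellipticCurve (orderLattice K (n * PNat.lcm f₁ f₂))).prod
        ((ellipticCurve (L₁ * L₂)).quot P hP))) := by
  obtain ⟨z, rfl⟩ : ∃ z : ℂ, (ellipticCurve (L₁ * L₂)).proj z = P := Submodule.mkQ_surjective _ P
  have hz : ∀ k : ℤ, (k : ℂ) * z ∈ toComplex (L₁ * L₂) ↔ ((n : ℕ) : ℤ) ∣ k := by
    intro k
    rw [← hn, addOrderOf_dvd_iff_zsmul_eq_zero, ← zsmul_eq_mul]
    exact (Submodule.Quotient.mk_eq_zero (toComplex (L₁ * L₂)) (x := k • z)).symm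
  -- a torsion point has coordinates in `K`
  obtain ⟨w, hw⟩ : ∃ w : K, (w : ℂ) = z := by
    obtain ⟨y, -, hy⟩ := (hz n).2 dvd_rfl
    refine ⟨y / (n : ℕ), ?_⟩
    have hn0 : ((n : ℕ) : ℂ) ≠ 0 := Nat.cast_ne_zero.2 n.ne_zero
    have hy' : (y : ℂ) = (n : ℕ) * z := hy
    push_cast
    rw [hy', mul_div_cancel_left₀ _ hn0]
  obtain rfl : (w : ℂ) = z := hw
  have hwK : ∀ k : ℤ, k * w ∈ L₁ * L₂ ↔ ((n : ℕ) : ℤ) ∣ k := fun k => by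
    rw [← hz k, ← mem_toComplex]
    simp
  have him₁ := im_ne_zero_of_isLattice h₁
  have him₂ := im_ne_zero_of_isLattice h₂
  obtain ⟨r, v, hrv, hiff⟩ := exists_fieldPeriodLattice_iff h₁ h₂ (indepOne_of_im_ne_zero him₁)
    (indepOne_of_im_ne_zero him₂) hf₁ hf₂ hwK
  have hrvC : (r.1 : ℂ) * v.1 + r.2 * v.2 = 1 := by exact_mod_cast congrArg Subtype.val hrv
  have hmem := mem_periodLattice_iff_unimodularEquiv (O := orderLattice K (n * PNat.lcm f₁ f₂))
    hrv hiff hrvC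
  obtain ⟨S, hS⟩ : ∃ S, S = unimodularEquiv (r.1, r.2) (v.1, v.2) hrvC := ⟨_, rfl⟩
  rw [← hS] at hmem
  obtain ⟨e, -, -⟩ := Quotient.exact (hX : X.cls = (periodExtension h₁ h₂ (w : ℂ)).cls)
  let A := ellipticCurve (L₁ * L₂)
  let B := (ellipticCurve (orderLattice K (n * PNat.lcm f₁ f₂))).prod (A.quot _ hP)
  have hB : ∀ x : ℂ × ℂ, x ∈ periodLattice (τ₁ : ℂ) τ₂ w ↔ (S x : ℂ × ℂ) ∈ B.Λ := fun x => by
    rw [hmem]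
    refine and_congr Iff.rfl (Iff.trans ?_ (mem_quot_lattice (A := A) hP).symm)
    refine exists_congr fun k => ?_
    rw [← zsmul_eq_mul]
    rfl
  refine ⟨e.trans (ComplexTorus.Iso.ofLinear (A := periodTorus him₁ him₂ (w : ℂ)) (B := B) S
    (fun x hx => (hB x).1 hx) fun x hx => (hB (S.symm x)).2 ?_)⟩
  have hx' : (S (S.symm x) : ℂ × ℂ) = x := S.apply_symm_apply x
  exact (congrArg (fun y : ℂ × ℂ => y ∈ B.Λ) hx').mpr hx

end Main
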